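/- Let $X$ be a non-compact connected Riemann surface with a complete hyperbolic metric $g_X$, i.e. a smooth complete Riemannian metric which in every local holomorphic coordinate $z$ has the form $g_X = g(z)\,|dz|^2$ and has Gauss curvature $-\frac{2}{g}\partial_z\partial_{\bar z}\log g = -1$; let $\Delta_{g_X} = \frac{4}{g}\partial_z\partial_{\bar z}$ be its Laplacian. Let $n$ be a natural number and consider, for tuples $u=(u_1,\dots,u_{n-1})$ of smooth real functions on $X$, the system $$\Delta_{g_X} u_i + i(n-i) - k_i\, e^{2u_i-u_{i-1}-u_{i+1}} = 0,\qquad 1\le i\le n-1,\qquad u_0=u_n=0. \tag{$*$}$$ A tuple $v=(v_1,\dots,v_{n-1})$ of smooth functions (with $v_0=v_n=0$) is a subsolution of $(*)$ if $\Delta_{g_X} v_i + i(n-i) - k_i\, e^{2v_i-v_{i-1}-v_{i+1}} \ge 0$ for $1\le i\le n-1$. A solution $u$ of $(*)$ is called maximal if $v_i\le u_i$ on $X$ for all $1\le i\le n-1$ and every subsolution $v$ of $(*)$. When $k_i = i(n-i)$ for all $1\le i\le n-1$, the zero tuple $(0,\dots,0)$ is the maximal solution of $(*)$. In particular, it is a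 solution, and every subsolution $v$ (hence every solution) satisfies $v_i\le 0$ on $X$ for all $i$. -/

import Mathlib

open Bundle Manifold
open scoped ContDiff

noncomputable section

namespace HyperbolicToda

/-- A Riemann surface, i.e. a manifold modelled on `ℂ` with complex analytic changes of
coordinates, is in particular a real analytic surface. -/
instance isManifold_real_of_complex {X : Type*} [TopologicalSpace X] [ChartedSpace ℂ X]
    [IsManifold 𝓘(ℂ, ℂ) ω X] : IsManifold 𝓘(ℝ, ℂ) ω X := by
  refine isManifold_of_contDiffOn 𝓘(ℝ, ℂ) ω X ?_
  intro e e' he he'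
  have h := HasGroupoid.compatible (G := contDiffGroupoid ω 𝓘(ℂ, ℂ)) he he'
  rw [contDiffGroupoid, mem_groupoid_of_pregroupoid] at h
  exact ContDiffOn.restrict_scalars ℝ h.1

section Metric

variable {X : Type*} [TopologicalSpace X] [ChartedSpace ℂ X]
  [RiemannianBundle (fun x : X => TangentSpace 𝓘(ℝ, ℂ) x)]

/-- The coefficient `g(z) = |∂/∂x|²` (where `z = x + i y`) of the Riemannian metric of `X` in the
coordinate `e`, as a function of `z ∈ e.target`. -/
def density (e : OpenPartialHomeomorph X ℂ) (z : ℂ) : ℝ :=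
  ‖mfderiv 𝓘(ℝ, ℂ) 𝓘(ℝ, ℂ) e.symm z (1 : ℂ)‖ ^ 2

/-- The Gauss curvature `-(2 / g) ∂_z ∂_{z̄} log g = -(1 / (2 g)) (∂_x² + ∂_y²) log g`
of the conformal metric `g(z) |dz|²`, computed in the coordinate `e`. -/
def gaussCurvature (e : OpenPartialHomeomorph X ℂ) (z : ℂ) : ℝ :=
  -(1 / (2 * density e z)) * Laplacian.laplacian (fun ζ : ℂ => Real.log (density e ζ)) z

/-- The Laplacian `Δ_g u = (4 / g) ∂_z ∂_{z̄} u = (1 / g) (∂_x² + ∂_y²) u` of a function `u` on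
`X`, for the conformal metric `g(z) |dz|²`, computed in the coordinate `e`. -/
def laplaceBeltrami (e : OpenPartialHomeomorph X ℂ) (u : X → ℝ) (z : ℂ) : ℝ :=
  1 / density e z * Laplacian.laplacian (fun ζ : ℂ => u (e.symm ζ)) z

variable (X) in
/-- The Riemannian metric of the Riemann surface `X` is hyperbolic: it is compatible with the
complex structure, that is, of the form `g(z) |dz|²` in every holomorphic coordinate of the
atlas, and its Gauss curvature is `-1`. -/
structure IsHyperbolicMetric : Prop where
  conformal : ∀ e ∈ atlas ℂ X, ∀ z ∈ e.target, ∀ w : ℂ,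
    ‖mfderiv 𝓘(ℝ, ℂ) 𝓘(ℝ, ℂ) e.symm z w‖ ^ 2 = density e z * ‖w‖ ^ 2
  curvature : ∀ e ∈ atlas ℂ X, ∀ z ∈ e.target, gaussCurvature e z = -1

/-- The left-hand side `Δ_g u_i + i (n - i) - k_i exp (2 u_i - u_{i-1} - u_{i+1})` of the `i`-th
equation of the system (`1 ≤ i ≤ n - 1`), at the point with coordinate `z` in the chart `e`. -/
def systemLHS (n : ℕ) (k u : ℕ → X → ℝ) (i : ℕ) (e : OpenPartialHomeomorph X ℂ) (z : ℂ) : ℝ :=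
  laplaceBeltrami e (u i) z + (i : ℝ) * ((n : ℝ) - (i : ℝ))
    - k i (e.symm z) *
      Real.exp (2 * u i (e.symm z) - u (i - 1) (e.symm z) - u (i + 1) (e.symm z))

/-- A tuple `(u_1, …, u_{n-1})` of smooth functions, extended by `u_0 = u_n = 0`
(only the entries of index `0, …, n` of the sequence `u` matter). -/
structure IsSmoothTuple (n : ℕ) (u : ℕ → X → ℝ) : Prop where
  zero_left : ∀ x, u 0 x = 0
  zero_right : ∀ x, u n x = 0
  smooth : ∀ i, 1 ≤ i → i < n → ContMDiff 𝓘(ℝ, ℂ) 𝓘(ℝ, ℝ) ∞ (u i)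

/-- Smooth subsolutions of the system. -/
structure IsSubsolution (n : ℕ) (k u : ℕ → X → ℝ) : Prop extends IsSmoothTuple n u where
  nonneg : ∀ i, 1 ≤ i → i < n → ∀ e ∈ atlas ℂ X, ∀ z ∈ e.target, 0 ≤ systemLHS n k u i e z

/-- Smooth solutions of the system. -/
structure IsSolution (n : ℕ) (k u : ℕ → X → ℝ) : Prop extends IsSmoothTuple n u where
  eq_zero : ∀ i, 1 ≤ i → i < n → ∀ e ∈ atlas ℂ X, ∀ z ∈ e.target, systemLHS n k u i e z = 0

/-- A solution is maximal if it dominates every subsolution, entry by entry. -/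
structure IsMaximalSolution (n : ℕ) (k u : ℕ → X → ℝ) : Prop extends IsSolution n k u where
  le : ∀ v : ℕ → X → ℝ, IsSubsolution n k v → ∀ i, 1 ≤ i → i < n → ∀ x, v i x ≤ u i x

end Metric

end HyperbolicToda

end

/-! Every point of `X` is the image of the origin under a holomorphic local isometry `φ` from the
Poincaré disc (`exists_isometry_disc`). Since `φ` pulls the Laplacian of `X` back to that of the
disc (`LocIsometryAt.laplacian_comp`), a subsolution pulls back to a subsolution on the disc, and a
bound at the origin is enough. No covering property of `φ` is needed.

On the disc (`subsolution_disc_nonpos`) the argument is Ahlfors' version of the Schwarz lemma. Write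
`c i = i (n - i)` and compare with the hyperbolic metric of a smaller disc of radius `r`, which
blows up at its boundary. Maximise `V i / c i`, corrected by half the logarithm of the ratio of the
two hyperbolic densities, over the point and the index simultaneously. If `M` is the value of `V i /
c i` at the maximum, then `V j ≤ c j * M` there for the neighbouring `j`, and `2 c i - c (i - 1) - c
(i + 1) = 2` bounds the exponent below by `2 M`. The system thus collapses to the scalar inequality
`Δ (V i) / c i ≥ P (exp (2 M) - 1)`, with `P` the Poincaré density, which the maximum principle
handles. Letting `r` tend to `1` concludes.

The map `φ` comes from three facts: Liouville's theorem, giving local isometries to the disc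
(`exists_developing_map`); rigidity, since isometries between pieces of the disc are Möbius maps
(`exists_extension_of_hypIsometry`); and completeness, which pushes an isometry defined on a disc of
radius `R < 1` past its boundary (`exists_extension`). -/

namespace HyperbolicToda

/-! ### Wirtinger calculus for real-differentiable functions on the plane. -/

section Wirtinger

open Complex Filter Topology ComplexConjugate

theorem two_le_infty : (2 : ℕ∞ω) ≤ ∞ := by
  have : ((2 : ℕ∞) : ℕ∞ω) ≤ ((⊤ : ℕ∞) : ℕ∞ω) := WithTop.coe_le_coe.2 le_top
  exact this

/-- `F` is real differentiable at `z`, with differential `A dz + B dz̄`. -/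
def HasWirtingerAt (F : ℂ → ℂ) (A B z : ℂ) : Prop :=
  HasFDerivAt F (A • ContinuousLinearMap.id ℝ ℂ + B • (conjCLE : ℂ →L[ℝ] ℂ)) z

/-- The Wirtinger derivative `∂F/∂z`. -/
noncomputable def wirtinger (F : ℂ → ℂ) (z : ℂ) : ℂ := (fderiv ℝ F z 1 - I * fderiv ℝ F z I) / 2

/-- The Wirtinger derivative `∂F/∂z̄`. -/
noncomputable def wirtingerBar (F : ℂ → ℂ) (z : ℂ) : ℂ :=
  (fderiv ℝ F z 1 + I * fderiv ℝ F z I) / 2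

variable {F G h : ℂ → ℂ} {A B C D z h' : ℂ}

theorem hasWirtingerAt_of_differentiableAt (hF : DifferentiableAt ℝ F z) :
    HasWirtingerAt F (wirtinger F z) (wirtingerBar F z) z := by
  refine HasFDerivAt.congr_fderiv hF.hasFDerivAt (ContinuousLinearMap.ext fun w => ?_)
  have hw : w = w.re • (1 : ℂ) + w.im • I := by simp
  have hc : conj w = w.re - w.im * I := by apply Complex.ext <;> simp
  have hw' : w = w.re + w.im * I := (re_add_im w).symm
  have h1 : fderiv ℝ F z w = w.re * fderiv ℝ F z 1 + w.im * fderiv ℝ F z I := by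
    conv_lhs => rw [hw, map_add, map_smul, map_smul]
    simp
  rw [h1]
  simp only [wirtinger, wirtingerBar, add_apply, smul_apply,
    ContinuousLinearMap.id_apply, smul_eq_mul, ContinuousLinearEquiv.coe_coe, conjCLE_apply, hc]
  linear_combination -(fderiv ℝ F z 1 - I * fderiv ℝ F z I) / 2 * hw' + w.im * fderiv ℝ F z I * I_sq

theorem HasWirtingerAt.apply_one (hF : HasWirtingerAt F A B z) : fderiv ℝ F z 1 = A + B := by
  rw [HasFDerivAt.fderiv hF]; simp

theorem HasWirtingerAt.apply_I (hF : HasWirtingerAt F A B z) :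
    fderiv ℝ F z I = I * (A - B) := by
  rw [HasFDerivAt.fderiv hF]; simp; ring

theorem HasWirtingerAt.unique (hF : HasWirtingerAt F A B z) (hF' : HasWirtingerAt F C D z) :
    A = C ∧ B = D := by
  have h1 := hF.apply_one.symm.trans hF'.apply_one
  have h2 := hF.apply_I.symm.trans hF'.apply_I
  have h3 := mul_left_cancel₀ I_ne_zero h2
  constructor
  · linear_combination (h1 + h3) / 2
  · linear_combination (h1 - h3) / 2

theorem HasWirtingerAt.congr (hF : HasWirtingerAt F A B z) (h1 : A = C) (h2 : B = D) :
    HasWirtingerAt F C D z := h1 ▸ h2 ▸ hF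

theorem HasWirtingerAt.congr_of_eventuallyEq (hF : HasWirtingerAt F A B z) (h : G =ᶠ[𝓝 z] F) :
    HasWirtingerAt G A B z := HasFDerivAt.congr_of_eventuallyEq hF h

theorem hasWirtingerAt_of_hasDerivAt (hh : HasDerivAt h h' z) : HasWirtingerAt h h' 0 z := by
  exact HasFDerivAt.congr_fderiv (hh.hasFDerivAt.restrictScalars ℝ) (ContinuousLinearMap.ext fun w => by simp [mul_comm])

theorem hasWirtingerAt_const (c : ℂ) : HasWirtingerAt (fun _ => c) 0 0 z := by
  simpa using hasWirtingerAt_of_hasDerivAt (hasDerivAt_const z c)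

theorem HasWirtingerAt.add (hF : HasWirtingerAt F A B z) (hG : HasWirtingerAt G C D z) :
    HasWirtingerAt (fun w => F w + G w) (A + C) (B + D) z := by
  exact HasFDerivAt.congr_fderiv (HasFDerivAt.add hF hG) (ContinuousLinearMap.ext fun w => by simp; ring)

theorem HasWirtingerAt.sub (hF : HasWirtingerAt F A B z) (hG : HasWirtingerAt G C D z) :
    HasWirtingerAt (fun w => F w - G w) (A - C) (B - D) z := by
  exact HasFDerivAt.congr_fderiv (HasFDerivAt.sub hF hG) (ContinuousLinearMap.ext fun w => by simp; ring)

theorem HasWirtingerAt.mul (hF : HasWirtingerAt F A B z) (hG : HasWirtingerAt G C D z) :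
    HasWirtingerAt (fun w => F w * G w) (A * G z + F z * C) (B * G z + F z * D) z := by
  exact HasFDerivAt.congr_fderiv (HasFDerivAt.mul hF hG) (ContinuousLinearMap.ext fun w => by simp; ring)

theorem HasWirtingerAt.conj (hF : HasWirtingerAt F A B z) :
    HasWirtingerAt (fun w => conj (F w)) (conj B) (conj A) z := by
  have := (conjCLE : ℂ →L[ℝ] ℂ).hasFDerivAt.comp z (show HasFDerivAt _ _ _ from hF)
  exact this.congr_fderiv (ContinuousLinearMap.ext fun w => by simp; try ring)

theorem HasWirtingerAt.comp_left {f : ℂ → ℂ} {f' : ℂ} (hf : HasDerivAt f f' (F z))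
    (hF : HasWirtingerAt F A B z) :
    HasWirtingerAt (fun w => f (F w)) (f' * A) (f' * B) z := by
  have := (hf.hasFDerivAt.restrictScalars ℝ).comp z (show HasFDerivAt _ _ _ from hF)
  exact this.congr_fderiv (ContinuousLinearMap.ext fun w => by simp; try ring)

theorem HasWirtingerAt.comp_right (hF : HasWirtingerAt F A B (h z)) (hh : HasDerivAt h h' z) :
    HasWirtingerAt (fun w => F (h w)) (A * h') (B * conj h') z := by
  have := (show HasFDerivAt _ _ _ from hF).comp z (hh.hasFDerivAt.restrictScalars ℝ)
  exact this.congr_fderiv (ContinuousLinearMap.ext fun w => by simp; try ring)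

theorem HasWirtingerAt.hasDerivAt (hF : HasWirtingerAt F A 0 z) : HasDerivAt F A z := by
  rw [hasDerivAt_iff_hasFDerivAt]
  unfold HasWirtingerAt at hF
  refine (hasFDerivAt_of_restrictScalars ℝ hF ?_)
  exact ContinuousLinearMap.ext fun w => by simp [mul_comm]

/-- A real function is its own conjugate, and conjugating a function swaps and conjugates its two
Wirtinger derivatives. -/
theorem HasWirtingerAt.eq_conj {u : ℂ → ℝ} (hF : HasWirtingerAt (fun w => (u w : ℂ)) A B z) :
    B = conj A := by
  have := hF.conj
  simp only [conj_ofReal] at this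
  exact (hF.unique this).2

/-- The mixed second Wirtinger derivatives agree. -/
theorem HasWirtingerAt.comm {A B : ℂ → ℂ} {a b c d : ℂ}
    (hF : ∀ᶠ w in 𝓝 z, HasWirtingerAt F (A w) (B w) w)
    (hA : HasWirtingerAt A a b z) (hB : HasWirtingerAt B c d z) : b = c := by
  unfold HasWirtingerAt at *
  have h2 : HasFDerivAt
      (fun w => A w • ContinuousLinearMap.id ℝ ℂ + B w • (conjCLE : ℂ →L[ℝ] ℂ))
      ((a • ContinuousLinearMap.id ℝ ℂ + b • (conjCLE : ℂ →L[ℝ] ℂ)).smulRight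
          (ContinuousLinearMap.id ℝ ℂ) +
        (c • ContinuousLinearMap.id ℝ ℂ + d • (conjCLE : ℂ →L[ℝ] ℂ)).smulRight
          (conjCLE : ℂ →L[ℝ] ℂ)) z :=
    (hA.smul_const (ContinuousLinearMap.id ℝ ℂ)).add (hB.smul_const (conjCLE : ℂ →L[ℝ] ℂ))
  have h3 := second_derivative_symmetric_of_eventually hF h2 1 I
  simp at h3
  -- The second differential at `(1, I)` minus that at `(I, 1)` is `2 I (b - c)`.
  have h4 : (2 * I) * (b - c) = 0 := by linear_combination h3
  have h5 := (mul_eq_zero.1 h4).resolve_left (by simp)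
  exact sub_eq_zero.1 h5

/-- The Laplacian is `4 ∂_z ∂_z̄`. -/
theorem HasWirtingerAt.laplacian {u : ℂ → ℝ} {A B : ℂ → ℂ} {a b c d : ℂ}
    (hu2 : ContDiffAt ℝ 2 u z)
    (hu : ∀ᶠ w in 𝓝 z, HasWirtingerAt (fun w => (u w : ℂ)) (A w) (B w) w)
    (hA : HasWirtingerAt A a b z) (hB : HasWirtingerAt B c d z) :
    ((Laplacian.laplacian u z : ℝ) : ℂ) = 4 * b := by
  have hbc := HasWirtingerAt.comm hu hA hB
  have key : ∀ᶠ w in 𝓝 z, ((fderiv ℝ u w 1 : ℝ) : ℂ) = A w + B w ∧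
      ((fderiv ℝ u w I : ℝ) : ℂ) = I * (A w - B w) := by
    have hd : ∀ᶠ w in 𝓝 z, DifferentiableAt ℝ u w := by
      filter_upwards [hu2.eventually (by simp)] with w hw
      exact hw.differentiableAt (by simp)
    filter_upwards [hu, hd] with w hw hdw
    have h1 : HasFDerivAt (fun w => (u w : ℂ)) (ofRealCLM.comp (fderiv ℝ u w)) w :=
      ofRealCLM.hasFDerivAt.comp w hdw.hasFDerivAt
    rw [← hw.apply_one, ← hw.apply_I, h1.fderiv]
    simp
  have hdd : DifferentiableAt ℝ (fderiv ℝ u) z :=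
    (hu2.fderiv_right (m := 1) (by norm_num)).differentiableAt (by simp)
  have e1 : HasFDerivAt (fun w => ((fderiv ℝ u w 1 : ℝ) : ℂ))
      (ofRealCLM.comp ((ContinuousLinearMap.apply ℝ ℝ (1 : ℂ)).comp (fderiv ℝ (fderiv ℝ u) z))) z :=
    ofRealCLM.hasFDerivAt.comp z
      ((ContinuousLinearMap.apply ℝ ℝ (1 : ℂ)).hasFDerivAt.comp z hdd.hasFDerivAt)
  have e2 : HasFDerivAt (fun w => ((fderiv ℝ u w I : ℝ) : ℂ))
      (ofRealCLM.comp ((ContinuousLinearMap.apply ℝ ℝ I).comp (fderiv ℝ (fderiv ℝ u) z))) z :=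
    ofRealCLM.hasFDerivAt.comp z
      ((ContinuousLinearMap.apply ℝ ℝ I).hasFDerivAt.comp z hdd.hasFDerivAt)
  -- `∂_x` of `A + B` gives `u_xx = a + b + c + d`; `∂_y` of `I (A - B)` gives `u_yy = -(a - b - c +
  -- d)`. With `b = c` the sum is `4 b`.
  have f1 := ((hA.add hB).congr_of_eventuallyEq (key.mono fun w hw => hw.1)).apply_one
  have f2 := (((hasWirtingerAt_const I).mul (hA.sub hB)).congr_of_eventuallyEq
    (key.mono fun w hw => hw.2)).apply_I
  rw [e1.fderiv] at f1
  rw [e2.fderiv] at f2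
  simp only [ContinuousLinearMap.comp_apply, ContinuousLinearMap.apply_apply, ofRealCLM_apply]
    at f1 f2
  rw [InnerProductSpace.laplacian_eq_iteratedFDeriv_complexPlane]
  simp only [iteratedFDeriv_two_apply, Matrix.cons_val_zero, Matrix.cons_val_one, ofReal_add]
  rw [f1, f2, ← hbc]
  linear_combination (a - 2 * b + d) * I_sq

theorem contDiffAt_wirtinger (hF : ContDiffAt ℝ ∞ F z) : ContDiffAt ℝ ∞ (wirtinger F) z := by
  have h : ContDiffAt ℝ ∞ (fderiv ℝ F) z := hF.fderiv_right (by simp)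
  unfold HyperbolicToda.wirtinger
  exact ((h.clm_apply contDiffAt_const).sub
    (contDiffAt_const.mul (h.clm_apply contDiffAt_const))).div_const _

/-- The Laplacian of the composition of a real function with a holomorphic map. -/
theorem laplacian_comp_holomorphic {u : ℂ → ℝ} (hu : ContDiffAt ℝ ∞ u (h z))
    (hh : ∀ᶠ w in 𝓝 z, DifferentiableAt ℂ h w) :
    Laplacian.laplacian (fun w => u (h w)) z =
      ‖deriv h z‖ ^ 2 * Laplacian.laplacian u (h z) := by
  set U : ℂ → ℂ := fun w => (u w : ℂ) with hU
  have hUs : ContDiffAt ℝ ∞ U (h z) := ofRealCLM.contDiff.contDiffAt.comp _ hu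
  have hev : ∀ᶠ w in 𝓝 (h z), HasWirtingerAt U (wirtinger U w) (conj (wirtinger U w)) w := by
    filter_upwards [(hUs.of_le (show (1 : ℕ∞ω) ≤ ∞ by simp)).eventually (by simp)] with w hw
    have := hasWirtingerAt_of_differentiableAt (hw.differentiableAt (by simp))
    exact this.congr rfl this.eq_conj
  have hA := hasWirtingerAt_of_differentiableAt ((contDiffAt_wirtinger hUs).differentiableAt (by simp))
  have l1 := HasWirtingerAt.laplacian (hu.of_le two_le_infty) hev hA hA.conj
  have han : AnalyticAt ℂ h z := analyticAt_iff_eventually_differentiableAt.2 hh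
  have hz : DifferentiableAt ℂ h z := han.differentiableAt
  have hd : HasDerivAt (deriv h) (deriv (deriv h) z) z :=
    han.deriv.differentiableAt.hasDerivAt
  have hcs : ContDiffAt ℝ ∞ h z := (han.contDiffAt (n := ∞)).restrict_scalars ℝ
  have hA2 := (HasWirtingerAt.comp_right hA hz.hasDerivAt).mul (hasWirtingerAt_of_hasDerivAt hd)
  have hev2 : ∀ᶠ w in 𝓝 z, HasWirtingerAt (fun w => ((u (h w) : ℝ) : ℂ))
      (wirtinger U (h w) * deriv h w) (conj (wirtinger U (h w) * deriv h w)) w := by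
    filter_upwards [hz.continuousAt.eventually hev, hh] with w hw hhw
    exact (HasWirtingerAt.comp_right hw hhw.hasDerivAt).congr rfl (by simp)
  have l2 := HasWirtingerAt.laplacian (u := fun w => u (h w))
    ((hu.comp z hcs).of_le two_le_infty) hev2 hA2 hA2.conj
  have : ((Laplacian.laplacian (fun w => u (h w)) z : ℝ) : ℂ) =
      ((‖deriv h z‖ ^ 2 * Laplacian.laplacian u (h z) : ℝ) : ℂ) := by
    rw [l2]
    push_cast
    rw [l1, ← mul_conj']
    ring
  exact_mod_cast this

end Wirtinger

/-! ### Linear second-order holomorphic equations and Liouville's theorem. -/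

section Liouville

open Complex Filter Topology ComplexConjugate Metric

/-- `y` is a holomorphic solution of `y'' = Q y` on `s`, with derivative `y'`. -/
def IsODESolution (Q y y' : ℂ → ℂ) (s : Set ℂ) : Prop :=
  ∀ z ∈ s, HasDerivAt y (y' z) z ∧ HasDerivAt y' (Q z * y z) z

theorem norm_le_of_hasDerivAt_ball {f f' : ℂ → ℂ} {z₀ : ℂ} {ε C : ℝ} (h₀ : f z₀ = 0)
    (hC : 0 ≤ C) (hf : ∀ z ∈ ball z₀ ε, HasDerivAt f (f' z) z)
    (hb : ∀ z ∈ ball z₀ ε, ‖f' z‖ ≤ C) :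
    ∀ z ∈ ball z₀ ε, ‖f z‖ ≤ C * ε := by
  intro z hz
  have hε : 0 < ε := dist_nonneg.trans_lt (mem_ball.1 hz)
  have := (convex_ball z₀ ε).norm_image_sub_le_of_norm_hasDerivWithin_le
    (fun w hw => (hf w hw).hasDerivWithinAt) hb (mem_ball_self hε) hz
  rw [h₀, sub_zero] at this
  refine this.trans (mul_le_mul_of_nonneg_left ?_ hC)
  rw [← dist_eq_norm]
  exact (mem_ball.1 hz).le

/-- Local solvability of the linear equation `y'' = Q y` with holomorphic coefficient. -/
theorem exists_isODESolution {Q : ℂ → ℂ} {z₀ : ℂ} {R : ℝ} (hR : 0 < R)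
    (hQ : DifferentiableOn ℂ Q (ball z₀ R)) :
    ∃ ε, 0 < ε ∧ ε ≤ R ∧ ∀ a b : ℂ, ∃ y y' : ℂ → ℂ, IsODESolution Q y y' (ball z₀ ε) ∧
      y z₀ = a ∧ y' z₀ = b := by
  obtain ⟨M, hM⟩ := (isCompact_closedBall z₀ (R / 2)).exists_bound_of_continuousOn
    (hQ.continuousOn.mono (closedBall_subset_ball (by linarith)))
  have hM0 : 0 ≤ M := (norm_nonneg _).trans (hM z₀ (mem_closedBall_self (by linarith)))
  -- Chosen so that `ε ≤ 1` and `M ε² ≤ 1/2`: integrating `Q t` twice from `z₀` then at least halves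
  -- sup bounds.
  set ε : ℝ := min (R / 2) (1 / (2 * (M + 1))) with hε
  have hε0 : 0 < ε := by positivity
  have hεR : ε ≤ R / 2 := min_le_left _ _
  have hε2 : ε * (2 * (M + 1)) ≤ 1 := by
    rw [← le_div_iff₀ (by positivity)]; exact min_le_right _ _
  have hε1 : ε ≤ 1 := by nlinarith
  have hεM : M * ε * ε ≤ 1 / 2 := by nlinarith [mul_nonneg hM0 hε0.le]
  set B := ball z₀ ε with hB
  have hz₀ : z₀ ∈ B := mem_ball_self hε0
  have hBo : IsOpen B := isOpen_ball
  have hQB : DifferentiableOn ℂ Q B := hQ.mono (ball_subset_ball (by linarith))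
  have hQM : ∀ z ∈ B, ‖Q z‖ ≤ M := fun z hz =>
    hM z (closedBall_subset_closedBall hεR (ball_subset_closedBall hz))
  refine ⟨ε, hε0, by linarith, fun a b => ?_⟩
  have step : ∀ t : ℂ → ℂ, DifferentiableOn ℂ t B → ∃ s T : ℂ → ℂ, s z₀ = 0 ∧ T z₀ = 0 ∧
      (∀ z ∈ B, HasDerivAt s (Q z * t z) z) ∧ (∀ z ∈ B, HasDerivAt T (s z) z) := by
    intro t ht
    obtain ⟨s, hs0, hs⟩ := (hQB.mul ht).isExactOn_ball.with_val_at z₀ 0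
    have hsd : DifferentiableOn ℂ s B := fun z hz =>
      (hs z hz).differentiableAt.differentiableWithinAt
    obtain ⟨T, hT0, hT⟩ := hsd.isExactOn_ball.with_val_at z₀ 0
    exact ⟨s, T, hs0, hT0, hs, hT⟩
  choose! s T hs0 hT0 hs hT using step
  -- Terms of the Picard series: `t 0` carries the initial data, and `t (n + 1)` is the double
  -- primitive of `Q * t n` vanishing to first order at `z₀`. The solution is `∑ t n`, with
  -- derivative `∑ σ n`.
  set t : ℕ → ℂ → ℂ := fun n => T^[n] (fun z => a + b * (z - z₀)) with ht
  have ht0 : t 0 = fun z => a + b * (z - z₀) := rfl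
  have htS : ∀ n, t (n + 1) = T (t n) := fun n => Function.iterate_succ_apply' _ _ _
  have htd : ∀ n, DifferentiableOn ℂ (t n) B := by
    intro n
    induction n with
    | zero => rw [ht0]; fun_prop
    | succ n ih =>
      rw [htS]
      exact fun z hz => (hT _ ih z hz).differentiableAt.differentiableWithinAt
  set σ : ℕ → ℂ → ℂ := fun n => n.casesOn (fun _ => b) (fun n => s (t n)) with hσ
  have hσ0 : σ 0 = fun _ => b := rfl
  have hσS : ∀ n, σ (n + 1) = s (t n) := fun n => rfl
  have htder : ∀ n, ∀ z ∈ B, HasDerivAt (t n) (σ n z) z := by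
    intro n z hz
    cases n with
    | zero =>
      rw [ht0, hσ0]
      simpa using (((hasDerivAt_id z).sub_const z₀).const_mul b).const_add a
    | succ n => rw [htS, hσS]; exact hT _ (htd n) z hz
  set C : ℝ := ‖a‖ + ‖b‖ with hC
  have hC0 : 0 ≤ C := by positivity
  have htb : ∀ n, ∀ z ∈ B, ‖t n z‖ ≤ C * (1 / 2) ^ n := by
    intro n
    induction n with
    | zero =>
      intro z hz
      rw [ht0, pow_zero, mul_one]
      refine (norm_add_le _ _).trans (add_le_add le_rfl ?_)
      rw [norm_mul, ← dist_eq_norm]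
      exact mul_le_of_le_one_right (norm_nonneg _) ((mem_ball.1 hz).le.trans hε1)
    | succ n ih =>
      have hpos : 0 ≤ C * (1 / 2 : ℝ) ^ n := by positivity
      have h1 : ∀ z ∈ B, ‖s (t n) z‖ ≤ M * (C * (1 / 2) ^ n) * ε :=
        norm_le_of_hasDerivAt_ball (hs0 _ (htd n)) (by positivity) (hs _ (htd n)) fun z hz => by
          rw [norm_mul]
          exact mul_le_mul (hQM z hz) (ih z hz) (norm_nonneg _) hM0
      have h2 : ∀ z ∈ B, ‖T (t n) z‖ ≤ M * (C * (1 / 2) ^ n) * ε * ε :=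
        norm_le_of_hasDerivAt_ball (hT0 _ (htd n)) (by positivity) (hT _ (htd n)) h1
      intro z hz
      rw [htS]
      refine (h2 z hz).trans ?_
      rw [pow_succ]
      nlinarith [mul_le_mul_of_nonneg_left hεM hpos]
  have hσb : ∀ n, ∀ z ∈ B, ‖σ n z‖ ≤ (‖b‖ + 2 * M * C * ε) * (1 / 2) ^ n := by
    intro n z hz
    cases n with
    | zero =>
      rw [hσ0]
      have : 0 ≤ 2 * M * C * ε := by positivity
      simp only [pow_zero, mul_one]
      linarith
    | succ n =>
      rw [hσS]
      have h1 : ‖s (t n) z‖ ≤ M * (C * (1 / 2) ^ n) * ε :=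
        norm_le_of_hasDerivAt_ball (hs0 _ (htd n)) (by positivity) (hs _ (htd n)) (fun z hz => by
          rw [norm_mul]
          exact mul_le_mul (hQM z hz) (htb n z hz) (norm_nonneg _) hM0) z hz
      refine h1.trans ?_
      have : 0 ≤ ‖b‖ * (1 / 2 : ℝ) ^ (n + 1) := by positivity
      rw [add_mul, pow_succ] at *
      nlinarith
  have hσd : ∀ n, DifferentiableOn ℂ (σ n) B := by
    intro n
    cases n with
    | zero => rw [hσ0]; fun_prop
    | succ n =>
      rw [hσS]
      exact fun z hz => (hs _ (htd n) z hz).differentiableAt.differentiableWithinAt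
  have hgeo : ∀ K : ℝ, Summable fun n : ℕ => K * (1 / 2 : ℝ) ^ n := fun K =>
    (summable_geometric_of_lt_one (by norm_num) (by norm_num)).mul_left K
  refine ⟨fun z => ∑' n, t n z, fun z => ∑' n, σ n z, fun z hz => ⟨?_, ?_⟩, ?_, ?_⟩
  · have h1 := ((differentiableOn_tsum_of_summable_norm (hgeo C) htd hBo htb) z hz).differentiableAt
      (hBo.mem_nhds hz)
    have h2 := hasSum_deriv_of_summable_norm (hgeo C) htd hBo htb hz
    have h3 : (fun n => deriv (t n) z) = fun n => σ n z := funext fun n => (htder n z hz).deriv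
    rw [h3] at h2
    have h4 := h1.hasDerivAt
    rwa [← h2.tsum_eq] at h4
  · have h1 := ((differentiableOn_tsum_of_summable_norm (hgeo _) hσd hBo hσb) z hz).differentiableAt
      (hBo.mem_nhds hz)
    have h2 := hasSum_deriv_of_summable_norm (hgeo _) hσd hBo hσb hz
    have h4 := h1.hasDerivAt
    rw [← h2.tsum_eq, h2.summable.tsum_eq_zero_add] at h4
    have h5 : ∀ n, deriv (σ (n + 1)) z = Q z * t n z := fun n => by
      rw [hσS]; exact (hs _ (htd n) z hz).deriv
    simp only [h5, hσ0, deriv_const, zero_add, tsum_mul_left] at h4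
    exact h4
  · beta_reduce
    rw [tsum_eq_single 0]
    · simp [ht0]
    · intro n hn
      obtain ⟨m, rfl⟩ := Nat.exists_eq_succ_of_ne_zero hn
      rw [htS]; exact hT0 _ (htd m)
  · beta_reduce
    rw [tsum_eq_single 0]
    · rfl
    intro n hn
    obtain ⟨m, rfl⟩ := Nat.exists_eq_succ_of_ne_zero hn
    rw [hσS]; exact hs0 _ (htd m)

/-- The equation has no first-order term, so the derivative of the Wronskian cancels to zero. -/
theorem IsODESolution.wronskian_eq {Q y y' Y Y' : ℂ → ℂ} {z₀ : ℂ} {ε : ℝ}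
    (hy : IsODESolution Q y y' (ball z₀ ε)) (hY : IsODESolution Q Y Y' (ball z₀ ε)) {z : ℂ}
    (hz : z ∈ ball z₀ ε) : y z * Y' z - y' z * Y z = y z₀ * Y' z₀ - y' z₀ * Y z₀ := by
  have hε : 0 < ε := dist_nonneg.trans_lt (mem_ball.1 hz)
  have := (convex_ball z₀ ε).norm_image_sub_le_of_norm_hasDerivWithin_le (C := 0)
    (f := fun z => y z * Y' z - y' z * Y z) (f' := fun _ => 0)
    (fun w hw => by
      have := (((hy w hw).1.mul (hY w hw).2).sub ((hy w hw).2.mul (hY w hw).1))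
      exact (this.congr_deriv (by ring)).hasDerivWithinAt)
    (fun w _ => by simp) (mem_ball_self hε) hz
  rw [zero_mul] at this
  exact sub_eq_zero.1 (norm_le_zero_iff.1 this)

/-- Liouville's theorem: a conformal metric of curvature `-1` is locally the pull-back of the
Poincaré metric of the unit disc by a holomorphic map. -/
theorem exists_developing_map {u : ℂ → ℝ} {z₀ : ℂ} {R : ℝ} (hR : 0 < R)
    (hu : ∀ z ∈ ball z₀ R, ContDiffAt ℝ ∞ u z)
    (hΔ : ∀ z ∈ ball z₀ R, Laplacian.laplacian u z = 2 * Real.exp (u z)) :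
    ∃ ε, 0 < ε ∧ ε ≤ R ∧ ∃ f f' : ℂ → ℂ, f z₀ = 0 ∧ ∀ z ∈ ball z₀ ε, HasDerivAt f (f' z) z ∧
      ‖f z‖ < 1 ∧ Real.exp (u z) * (1 - ‖f z‖ ^ 2) ^ 2 = 4 * ‖f' z‖ ^ 2 := by
  set U : ℂ → ℂ := fun w => (u w : ℂ) with hU
  set p := wirtinger U with hp
  set q := wirtinger p with hq
  set G : ℂ → ℂ := fun w => exp (U w) with hG
  set E : ℂ → ℂ := fun w => exp (-U w / 2) with hE
  have hUs : ∀ z ∈ ball z₀ R, ContDiffAt ℝ ∞ U z := fun z hz =>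
    ofRealCLM.contDiff.contDiffAt.comp _ (hu z hz)
  have wU : ∀ z ∈ ball z₀ R, HasWirtingerAt U (p z) (conj (p z)) z := fun z hz => by
    have := hasWirtingerAt_of_differentiableAt ((hUs z hz).differentiableAt (by simp))
    exact this.congr rfl this.eq_conj
  have evU : ∀ z ∈ ball z₀ R, ∀ᶠ w in 𝓝 z, HasWirtingerAt U (p w) (conj (p w)) w :=
    fun z hz => by
      filter_upwards [isOpen_ball.mem_nhds hz] with w hw using wU w hw
  have hps : ∀ z ∈ ball z₀ R, ContDiffAt ℝ ∞ p z := fun z hz => contDiffAt_wirtinger (hUs z hz)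
  have hqs : ∀ z ∈ ball z₀ R, ContDiffAt ℝ ∞ q z := fun z hz => contDiffAt_wirtinger (hps z hz)
  have wp : ∀ z ∈ ball z₀ R, HasWirtingerAt p (q z) (G z / 2) z := fun z hz => by
    have h1 := hasWirtingerAt_of_differentiableAt ((hps z hz).differentiableAt (by simp))
    have h2 := HasWirtingerAt.laplacian ((hu z hz).of_le two_le_infty) (evU z hz) h1 h1.conj
    rw [hΔ z hz] at h2
    refine h1.congr rfl ?_
    simp only [hG, hU]
    push_cast at h2
    linear_combination -h2 / 4
  have wG : ∀ z ∈ ball z₀ R, HasWirtingerAt G (G z * p z) (G z * conj (p z)) z := fun z hz =>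
    HasWirtingerAt.comp_left (Complex.hasDerivAt_exp _) (wU z hz)
  have wE : ∀ z ∈ ball z₀ R,
      HasWirtingerAt E (-(p z) / 2 * E z) (-(conj (p z)) / 2 * E z) z := fun z hz => by
    have h1 : HasDerivAt (fun t : ℂ => exp (-t / 2)) (E z * (-1 / 2)) (U z) :=
      (((hasDerivAt_id (U z)).neg).div_const 2).cexp
    exact (HasWirtingerAt.comp_left h1 (wU z hz)).congr (by ring) (by ring)
  -- The potential for which `E = exp (-U / 2)` satisfies `∂_z² E = Q E`. The curvature equation, in
  -- the form `∂_z̄ p = G / 2`, is exactly what makes `Q` holomorphic.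
  set Q : ℂ → ℂ := fun w => -(q w - p w * p w / 2) / 2 with hQ
  have dQ : DifferentiableOn ℂ Q (ball z₀ R) := fun z hz => by
    have h1 := hasWirtingerAt_of_differentiableAt ((hqs z hz).differentiableAt (by simp))
    have h2 : wirtingerBar q z = G z * p z / 2 := by
      have := HasWirtingerAt.comm
        (by filter_upwards [isOpen_ball.mem_nhds hz] with w hw using wp w hw) h1
        (HasWirtingerAt.comp_left ((hasDerivAt_id (G z)).div_const 2) (wG z hz))
      rw [this]; ring
    have h3 := HasWirtingerAt.comp_left (((hasDerivAt_id _).neg).div_const 2)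
      (h1.sub (HasWirtingerAt.comp_left ((hasDerivAt_id _).div_const 2) ((wp z hz).mul (wp z hz))))
    exact (h3.congr rfl (D := 0) (by rw [h2]; ring)).hasDerivAt.differentiableAt.differentiableWithinAt
  obtain ⟨ε, hε, hεR, hex⟩ := exists_isODESolution hR dQ
  have hsub : ball z₀ ε ⊆ ball z₀ R := ball_subset_ball hεR
  -- `Y₁` has the same logarithmic `z`-derivative at `z₀` as `E`; this choice makes the Hermitian
  -- form in `hErep` diagonal.
  obtain ⟨Y₁, Y₁', hY₁, h10, h11⟩ := hex 1 (-(p z₀) / 2)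
  obtain ⟨Y₂, Y₂', hY₂, h20, h21⟩ := hex 0 1
  have hz₀ : z₀ ∈ ball z₀ ε := mem_ball_self hε
  -- The bracket is the Wronskian in `z̄` of `E` and `conj Y`. Both solve the conjugate equation in
  -- `z̄`, so it is holomorphic; in `z` it inherits the equation `y'' = Q y` from `E`.
  have key : ∀ Y Y' : ℂ → ℂ, IsODESolution Q Y Y' (ball z₀ ε) →
      IsODESolution Q (fun z => E z * (conj (Y' z) + conj (p z) / 2 * conj (Y z)))
        (fun z => -(p z) / 2 * (E z * (conj (Y' z) + conj (p z) / 2 * conj (Y z))) +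
          E z * (G z / 4) * conj (Y z)) (ball z₀ ε) := by
    intro Y Y' hY z hz
    have hz' := hsub hz
    have w1 := (hasWirtingerAt_of_hasDerivAt (hY z hz).1).conj
    have w2 := (hasWirtingerAt_of_hasDerivAt (hY z hz).2).conj
    have w3 := HasWirtingerAt.comp_left (((hasDerivAt_id _).div_const 2)) (wp z hz').conj
    have w4 := HasWirtingerAt.comp_left (((hasDerivAt_id _).neg).div_const 2) (wp z hz')
    have w5 := HasWirtingerAt.comp_left (((hasDerivAt_id _).div_const 4)) (wG z hz')
    have wa := (wE z hz').mul (w2.add (w3.mul w1))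
    have hcG : conj (G z) = G z := by
      simp only [hG, hU, ← Complex.exp_conj, conj_ofReal]
    constructor
    · refine (wa.congr ?_ ?_).hasDerivAt
      · simp [hcG, map_ofNat]; ring
      · simp [hQ, map_ofNat]; ring
    · refine (((w4.mul wa).add (((wE z hz').mul w5).mul w1)).congr ?_ ?_).hasDerivAt
      · simp [hQ, hcG, map_ofNat]; ring
      · simp [hQ, map_ofNat]; ring
  have hW : ∀ z ∈ ball z₀ ε, Y₁ z * Y₂' z - Y₁' z * Y₂ z = 1 := fun z hz => by
    rw [hY₁.wronskian_eq hY₂ hz, h10, h20, h21]; ring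
  have cramer : ∀ Y Y' : ℂ → ℂ, IsODESolution Q Y Y' (ball z₀ ε) → ∀ z ∈ ball z₀ ε,
      Y z = Y₁ z * (Y z₀ * Y₂' z₀ - Y' z₀ * Y₂ z₀) - Y₂ z * (Y z₀ * Y₁' z₀ - Y' z₀ * Y₁ z₀) := by
    intro Y Y' hY z hz
    rw [← hY.wronskian_eq hY₂ hz, ← hY.wronskian_eq hY₁ hz]
    linear_combination -(Y z) * hW z hz
  have c1 := cramer _ _ (key _ _ hY₁)
  have c2 := cramer _ _ (key _ _ hY₂)
  simp only [h10, h11, h20, h21, map_one, map_zero, map_neg, map_div₀, map_ofNat] at c1 c2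
  have hcE : ∀ z, conj (E z) = E z := fun z => by
    simp only [hE, hU, ← Complex.exp_conj, map_div₀, map_neg, conj_ofReal, map_ofNat]
  have hErep : ∀ z ∈ ball z₀ ε,
      E z = E z₀ * (Y₁ z * conj (Y₁ z)) - E z₀ * (G z₀ / 4) * (Y₂ z * conj (Y₂ z)) := by
    intro z hz
    have d1 := congrArg conj (c1 z hz)
    have d2 := congrArg conj (c2 z hz)
    have hcG : conj (G z₀) = G z₀ := by
      simp only [hG, hU, ← Complex.exp_conj, conj_ofReal]
    simp only [map_mul, map_add, map_sub, map_div₀, map_neg, map_one, map_zero, map_ofNat,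
      Complex.conj_conj, hcE, hcG] at d1 d2
    -- Eliminating the derivatives: the terms in `p` cancel and the Wronskian of `Y₁`, `Y₂`, equal
    -- to `1`, leaves `E z`.
    linear_combination Y₁ z * d2 - Y₂ z * d1 - E z * hW z hz
  set g₀ := Real.exp (u z₀) with hg₀
  set e : ℂ → ℝ := fun z => Real.exp (-u z / 2) with he
  have hEe : ∀ z, E z = e z := fun z => by simp [hE, he, hU]
  have hGg : G z₀ = g₀ := by simp [hG, hg₀, hU]
  have hrep : ∀ z ∈ ball z₀ ε,
      e z = e z₀ * ‖Y₁ z‖ ^ 2 - e z₀ * (g₀ / 4) * ‖Y₂ z‖ ^ 2 := by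
    intro z hz
    have := hErep z hz
    rw [hEe, hEe, hGg, mul_conj', mul_conj'] at this
    exact_mod_cast this
  have hepos : ∀ z, 0 < e z := fun z => Real.exp_pos _
  have hg₀pos : 0 < g₀ := Real.exp_pos _
  have hge : ∀ z, Real.exp (u z) * e z ^ 2 = 1 := fun z => by
    simp only [he]; rw [← Real.exp_nat_mul, ← Real.exp_add, Real.exp_eq_one_iff]; push_cast; ring
  have hY₁0 : ∀ z ∈ ball z₀ ε, Y₁ z ≠ 0 := by
    intro z hz h0
    have := hrep z hz
    rw [h0, norm_zero] at this
    have h2 : 0 ≤ e z₀ * (g₀ / 4) * ‖Y₂ z‖ ^ 2 :=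
      mul_nonneg (mul_nonneg (hepos _).le (by positivity)) (by positivity)
    have := hepos z
    nlinarith
  -- The developing map is `k Y₂ / Y₁`. This `k` turns `hrep` into `e z = e z₀ ‖Y₁‖² (1 - ‖f‖²)`,
  -- and the Wronskian gives `f' = k / Y₁²`.
  set k : ℝ := Real.sqrt g₀ / 2 with hk
  have hk2 : k ^ 2 = g₀ / 4 := by rw [hk, div_pow, Real.sq_sqrt hg₀pos.le]; norm_num
  refine ⟨ε, hε, hεR, fun z => k * (Y₂ z / Y₁ z), fun z => k * (1 / Y₁ z ^ 2), by simp [h20], ?_⟩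
  intro z hz
  have hy := hY₁0 z hz
  have hyn : 0 < ‖Y₁ z‖ := norm_pos_iff.2 hy
  have h1 : 1 - ‖(k : ℂ) * (Y₂ z / Y₁ z)‖ ^ 2 = e z / (e z₀ * ‖Y₁ z‖ ^ 2) := by
    have h0 := hepos z₀
    have hn : ‖(k : ℂ) * (Y₂ z / Y₁ z)‖ ^ 2 = g₀ / 4 * (‖Y₂ z‖ ^ 2 / ‖Y₁ z‖ ^ 2) := by
      rw [norm_mul, norm_div, mul_pow, div_pow, norm_real, Real.norm_eq_abs, sq_abs, hk2]
    rw [hn, hrep z hz]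
    field_simp
  refine ⟨?_, ?_, ?_⟩
  · have := ((hY₂ z hz).1.div (hY₁ z hz).1 hy).const_mul (k : ℂ)
    refine this.congr_deriv ?_
    congr 2
    linear_combination hW z hz
  · have : 0 < e z / (e z₀ * ‖Y₁ z‖ ^ 2) := div_pos (hepos _) (mul_pos (hepos _) (by positivity))
    rw [← h1] at this
    nlinarith [norm_nonneg ((k : ℂ) * (Y₂ z / Y₁ z))]
  · rw [h1, norm_mul, norm_div, mul_pow, norm_real, Real.norm_eq_abs, sq_abs, hk2, norm_pow,
      norm_one]
    have h0 := hepos z₀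
    have a1 := hge z
    have a2 := hge z₀
    rw [div_pow, mul_div_assoc', a1, mul_pow]
    have a3 : (e z₀) ^ 2 = 1 / g₀ := by rw [eq_div_iff hg₀pos.ne', mul_comm]; exact a2
    rw [a3]
    field_simp

end Liouville

/-! ### Rigidity of holomorphic isometries of the Poincaré disc. -/

section Moebius

open Complex Filter Topology ComplexConjugate Metric Set

/-- `h` is holomorphic at `z`, with values in the unit disc, and its differential at `z` is an
isometry for the Poincaré metric of the unit disc. -/
structure HypIsometryAt (h : ℂ → ℂ) (z : ℂ) : Prop where
  differentiableAt : DifferentiableAt ℂ h z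
  norm_lt_one : ‖h z‖ < 1
  norm_deriv : ‖deriv h z‖ * (1 - ‖z‖ ^ 2) = 1 - ‖h z‖ ^ 2

theorem one_sub_sq_pos {z : ℂ} (hz : ‖z‖ < 1) : 0 < 1 - ‖z‖ ^ 2 := by
  nlinarith [norm_nonneg z]

theorem HypIsometryAt.comp {g h : ℂ → ℂ} {z : ℂ} (hg : HypIsometryAt g (h z))
    (hh : HypIsometryAt h z) : HypIsometryAt (g ∘ h) z := by
  refine ⟨hg.1.comp z hh.1, hg.2, ?_⟩
  rw [deriv_comp z hg.1 hh.1, norm_mul, mul_assoc, hh.3]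
  exact hg.3

theorem HypIsometryAt.congr {g h : ℂ → ℂ} {z : ℂ} (hg : HypIsometryAt g z) (h1 : h =ᶠ[𝓝 z] g) :
    HypIsometryAt h z :=
  ⟨hg.1.congr_of_eventuallyEq h1, h1.eq_of_nhds ▸ hg.2, by rw [h1.deriv_eq, h1.eq_of_nhds, hg.3]⟩

/-- The automorphism of the unit disc with `a ↦ 0`. -/
noncomputable def moebius (a z : ℂ) : ℂ := (z - a) / (1 - conj a * z)

variable {a z : ℂ}

theorem moebius_denom_ne_zero (ha : ‖a‖ < 1) (hz : ‖z‖ < 1) : 1 - conj a * z ≠ 0 := by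
  intro h
  have h1 : conj a * z = 1 := (sub_eq_zero.1 h).symm
  have h2 := congrArg norm h1
  rw [norm_mul, norm_conj, norm_one] at h2
  nlinarith [norm_nonneg a, norm_nonneg z]

/-- After clearing denominators this is the polynomial identity `|1 - āz|² - |z - a|² = (1 - |a|²)(1
- |z|²)`. It yields both the invariance of the disc and the isometry property. -/
theorem one_sub_norm_moebius_sq (ha : ‖a‖ < 1) (hz : ‖z‖ < 1) :
    1 - ‖moebius a z‖ ^ 2 = (1 - ‖a‖ ^ 2) * (1 - ‖z‖ ^ 2) / ‖1 - conj a * z‖ ^ 2 := by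
  have h0 := moebius_denom_ne_zero ha hz
  have h1 : 0 < ‖1 - conj a * z‖ := norm_pos_iff.2 h0
  rw [moebius, norm_div, div_pow, eq_div_iff (by positivity), sub_mul,
    div_mul_cancel₀ _ (by positivity), one_mul]
  have : ((‖1 - conj a * z‖ ^ 2 - ‖z - a‖ ^ 2 : ℝ) : ℂ) =
      (((1 - ‖a‖ ^ 2) * (1 - ‖z‖ ^ 2) : ℝ) : ℂ) := by
    push_cast
    simp only [← mul_conj', map_sub, map_mul, map_one, Complex.conj_conj]
    ring
  exact_mod_cast this

theorem hypIsometryAt_moebius (ha : ‖a‖ < 1) (hz : ‖z‖ < 1) : HypIsometryAt (moebius a) z := by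
  have h0 := moebius_denom_ne_zero ha hz
  have h1 : 0 < ‖1 - conj a * z‖ := norm_pos_iff.2 h0
  have hd : HasDerivAt (moebius a) ((1 - conj a * a) / (1 - conj a * z) ^ 2) z := by
    have h2 := (((hasDerivAt_id z).sub_const a).div
      (((hasDerivAt_id z).const_mul (conj a)).const_sub 1) h0)
    refine h2.congr_deriv ?_
    simp only [id]
    ring
  have hs := one_sub_norm_moebius_sq ha hz
  refine ⟨hd.differentiableAt, ?_, ?_⟩
  · have : 0 < 1 - ‖moebius a z‖ ^ 2 := by
      rw [hs]
      have := one_sub_sq_pos ha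
      have := one_sub_sq_pos hz
      positivity
    nlinarith [norm_nonneg (moebius a z)]
  · have h3 : (1 - conj a * a : ℂ) = ((1 - ‖a‖ ^ 2 : ℝ) : ℂ) := by
      push_cast; rw [← conj_mul']
    rw [hd.deriv, hs, h3, norm_div, norm_pow, norm_real, Real.norm_eq_abs,
      abs_of_pos (one_sub_sq_pos ha)]
    ring

theorem moebius_neg_moebius (ha : ‖a‖ < 1) (hz : ‖z‖ < 1) : moebius (-a) (moebius a z) = z := by
  have h0 := moebius_denom_ne_zero ha hz
  have h1 := moebius_denom_ne_zero (a := -a) (by simpa using ha) (hypIsometryAt_moebius ha hz).2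
  rw [moebius, div_eq_iff h1]
  have h2 : moebius a z * (1 - conj a * z) = z - a := div_mul_cancel₀ _ h0
  rw [map_neg]
  linear_combination h2

theorem moebius_self : moebius a a = 0 := by simp [moebius]

theorem hypIsometryAt_const_mul {c : ℂ} (hc : ‖c‖ = 1) (hz : ‖z‖ < 1) :
    HypIsometryAt (fun w => c * w) z := by
  have hd : HasDerivAt (fun w => c * w) c z := by simpa using (hasDerivAt_id z).const_mul c
  exact ⟨hd.differentiableAt, by simpa [hc] using hz, by rw [hd.deriv, norm_mul, hc]; ring⟩

/-- A holomorphic isometry of the Poincaré metric fixing the origin is a rotation. -/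
theorem eq_rotation_of_hypIsometry {h : ℂ → ℂ} {ε : ℝ} (hε : 0 < ε) (hε1 : ε ≤ 1)
    (hh : ∀ z ∈ ball (0 : ℂ) ε, HypIsometryAt h z) (h0 : h 0 = 0) :
    ∃ c : ℂ, ‖c‖ = 1 ∧ ∀ z ∈ ball (0 : ℂ) ε, h z = c * z := by
  have hle : ∀ z ∈ ball (0 : ℂ) ε, ‖h z‖ ≤ ‖z‖ := by
    intro z hz
    have hz' : ‖z‖ < ε := by simpa using hz
    have hmem : ∀ t ∈ Icc (0 : ℝ) 1, (t : ℂ) * z ∈ ball (0 : ℂ) ε := fun t ht => by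
      rw [mem_ball_zero_iff, norm_mul, norm_real, Real.norm_eq_abs, abs_of_nonneg ht.1]
      nlinarith [ht.2, norm_nonneg z]
    have hder : ∀ t ∈ Icc (0 : ℝ) 1,
        HasDerivAt (fun t : ℝ => h (t * z)) (deriv h (t * z) * z) t := fun t ht => by
      have h1 := (hh _ (hmem t ht)).1.hasDerivAt
      have h2 : HasDerivAt (fun t : ℝ => (t : ℂ) * z) z t := by
        simpa using (ofRealCLM.hasDerivAt (x := t)).mul_const z
      exact h1.comp t h2
    rcases eq_or_ne z 0 with rfl | hz0
    · simp [h0]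
    have hzp : 0 < ‖z‖ := norm_pos_iff.2 hz0
    have hδ : ∀ δ : ℝ, 0 < δ → ‖h z‖ ≤ ‖z‖ + δ * ‖z‖ := by
      intro δ hδ
      -- Comparison along the radius with slope `(1 + δ) ‖z‖`. At a contact point `‖h‖ ≥ ‖t z‖`, so
      -- the isometry relation forces `‖h'‖ ≤ 1`; the slack `δ` makes the inequality strict.
      have := image_norm_le_of_norm_deriv_right_lt_deriv_boundary (a := 0) (b := 1)
        (f := fun t : ℝ => h (t * z)) (B := fun t => t * ((1 + δ) * ‖z‖))
        (B' := fun _ => (1 + δ) * ‖z‖)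
        (fun t ht => (hder t ht).continuousAt.continuousWithinAt)
        (fun t ht => (hder t (Ico_subset_Icc_self ht)).hasDerivWithinAt)
        (by simp [h0]) (fun t => by simpa using (hasDerivAt_id t).mul_const ((1 + δ) * ‖z‖))
        (fun t ht heq => by
          have h1 := (hh _ (hmem t (Ico_subset_Icc_self ht))).3
          have h2 : ‖(t : ℂ) * z‖ = t * ‖z‖ := by
            rw [norm_mul, norm_real, Real.norm_eq_abs, abs_of_nonneg ht.1]
          have h3 : t * ‖z‖ < 1 := by nlinarith [ht.2, ht.1]
          have h4 : 0 ≤ t * ‖z‖ := mul_nonneg ht.1 hzp.le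
          have h5 : ‖deriv h (t * z)‖ ≤ 1 := by
            have h6 : 0 < 1 - (t * ‖z‖) ^ 2 := by nlinarith
            rw [h2, heq] at h1
            refine le_of_mul_le_mul_right ?_ h6
            rw [h1]
            have : (t * ‖z‖) ^ 2 ≤ (t * ((1 + δ) * ‖z‖)) ^ 2 :=
              pow_le_pow_left₀ h4 (by nlinarith [mul_nonneg hδ.le h4]) 2
            linarith
          rw [norm_mul]
          nlinarith [mul_pos hδ hzp])
        (right_mem_Icc.2 zero_le_one)
      simp only [ofReal_one, one_mul] at this
      linarith
    refine le_of_forall_pos_le_add fun η hη => ?_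
    have := hδ (η / ‖z‖) (by positivity)
    rwa [div_mul_cancel₀ _ hzp.ne'] at this
  have hb : MapsTo h (ball 0 ε) (closedBall (h 0) ε) := fun z hz => by
    rw [h0, mem_closedBall_zero_iff]
    exact (hle z hz).trans (by simpa using (mem_ball.1 hz).le)
  have hd : DifferentiableOn ℂ h (ball 0 ε) := fun z hz => (hh z hz).1.differentiableWithinAt
  have h1 : ‖deriv h 0‖ = 1 := by simpa [h0] using (hh 0 (mem_ball_self hε)).3
  -- Equality case of the Schwarz lemma: `h` maps the ball of radius `ε` into the closed one and
  -- `‖h' 0‖ = 1`.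
  have := affine_of_mapsTo_ball_of_norm_dslope_eq_div hd hb (mem_ball_self hε)
    (by rw [dslope_same, h1, div_self hε.ne'])
  refine ⟨deriv h 0, h1, fun z hz => ?_⟩
  have h2 := this hz
  simp only [h0, dslope_same, sub_zero, zero_add, smul_eq_mul] at h2
  rw [h2, mul_comm]

/-- A holomorphic isometry of the Poincaré metric on a connected open subset of the unit disc
extends to the unit disc. -/
theorem exists_extension_of_hypIsometry {h : ℂ → ℂ} {W : Set ℂ} (hWo : IsOpen W)
    (hWc : IsPreconnected W) (hW : W ⊆ ball 0 1) (hne : W.Nonempty)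
    (hh : ∀ z ∈ W, HypIsometryAt h z) :
    ∃ A : ℂ → ℂ, (∀ z ∈ ball (0 : ℂ) 1, HypIsometryAt A z) ∧ EqOn h A W := by
  obtain ⟨z₀, hz₀⟩ := hne
  have hz₀' : ‖z₀‖ < 1 := by simpa using hW hz₀
  set b := h z₀ with hb
  have hb1 : ‖b‖ < 1 := (hh z₀ hz₀).2
  have hnz : ‖-z₀‖ < 1 := by simpa using hz₀'
  have hnb : ‖-b‖ < 1 := by simpa using hb1
  have hT0 : moebius (-z₀) 0 = z₀ := by simp [moebius]
  have hcont : ContinuousAt (moebius (-z₀)) 0 :=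
    (hypIsometryAt_moebius hnz (by simp)).1.continuousAt
  obtain ⟨ε, hε, hεW⟩ := Metric.mem_nhds_iff.1
    (hcont.preimage_mem_nhds (by rw [hT0]; exact hWo.mem_nhds hz₀))
  -- Möbius maps move `z₀` and `h z₀` to the origin, reducing to a rotation. Undoing them gives a
  -- map defined on the whole disc, equal to `h` near `z₀` and hence on `W` by the identity theorem.
  obtain ⟨c, hc, hrot⟩ := eq_rotation_of_hypIsometry (ε := min ε 1)
    (h := fun z => moebius b (h (moebius (-z₀) z)))
    (by positivity) (min_le_right _ _)
    (fun z hz => by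
      have hzε : z ∈ ball (0 : ℂ) ε := ball_subset_ball (min_le_left _ _) hz
      have hz1 : ‖z‖ < 1 := by
        simpa using ball_subset_ball (min_le_right ε 1) hz
      have h1 := hypIsometryAt_moebius hnz hz1
      have h2 := hh _ (hεW hzε)
      exact HypIsometryAt.comp (h := h ∘ moebius (-z₀)) (hypIsometryAt_moebius hb1 h2.2) (h2.comp h1))
    (by simp only [hT0]; exact moebius_self)
  have hA : ∀ z ∈ ball (0 : ℂ) 1, HypIsometryAt (fun z => moebius (-b) (c * moebius z₀ z)) z := by
    intro z hz
    have h1 := hypIsometryAt_moebius hz₀' (show ‖z‖ < 1 by simpa using hz)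
    have h2 := hypIsometryAt_const_mul hc h1.2
    exact HypIsometryAt.comp (h := (fun w => c * w) ∘ moebius z₀) (hypIsometryAt_moebius hnb h2.2)
      (h2.comp h1)
  refine ⟨_, hA, ?_⟩
  refine AnalyticOnNhd.eqOn_of_preconnected_of_eventuallyEq
    (DifferentiableOn.analyticOnNhd (fun z hz => (hh z hz).1.differentiableWithinAt) hWo)
    (DifferentiableOn.analyticOnNhd (fun z hz => (hA z (hW hz)).1.differentiableWithinAt) hWo)
    hWc hz₀ ?_
  have hc2 : ContinuousAt (moebius z₀) z₀ := (hypIsometryAt_moebius hz₀' hz₀').1.continuousAt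
  filter_upwards [hWo.mem_nhds hz₀, hc2.preimage_mem_nhds
    (by rw [moebius_self]; exact ball_mem_nhds 0 (show 0 < min ε 1 by positivity))] with w hw hw2
  have h3 := hrot _ hw2
  have hw1 : ‖w‖ < 1 := by simpa using hW hw
  rw [moebius_neg_moebius hz₀' hw1] at h3
  rw [← h3, moebius_neg_moebius hb1 (hh w hw).2]

end Moebius

/-! ### The maximum principle and the estimate on the disc. -/

section MaximumPrinciple

open Complex Filter Topology ComplexConjugate Metric Set

/-- The coefficient of the Poincaré metric of the unit disc. -/
noncomputable def poincareDensity (z : ℂ) : ℝ := 4 / (1 - ‖z‖ ^ 2) ^ 2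

/-- A positive second derivative would make `x` a local minimum too, so `f` would be locally
constant and its second derivative zero. -/
theorem IsLocalMax.deriv_deriv_nonpos {f : ℝ → ℝ} {x : ℝ} (hf : IsLocalMax f x)
    (hc : ContinuousAt f x) : deriv (deriv f) x ≤ 0 := by
  by_contra! h
  have h1 := isLocalMin_of_deriv_deriv_pos h hf.deriv_eq_zero hc
  have h2 : f =ᶠ[𝓝 x] fun _ => f x := by
    filter_upwards [hf, h1] with y hy hy' using le_antisymm hy hy'
  rw [h2.deriv.deriv_eq] at h
  simp at h

theorem IsLocalMax.iteratedFDeriv_two_nonpos {u : ℂ → ℝ} {z : ℂ} (hu : ContDiffAt ℝ 2 u z)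
    (hmax : IsLocalMax u z) (v : ℂ) : iteratedFDeriv ℝ 2 u z ![v, v] ≤ 0 := by
  have hline : ∀ t : ℝ, HasDerivAt (fun t : ℝ => z + t * v) v t := fun t => by
    simpa using ((ofRealCLM.hasDerivAt (x := t)).mul_const v).const_add z
  have hz : z + ((0 : ℝ) : ℂ) * v = z := by simp
  have hcont : Tendsto (fun t : ℝ => z + t * v) (𝓝 0) (𝓝 z) := by
    have := (hline 0).continuousAt.tendsto
    rwa [hz] at this
  have h1 : ∀ᶠ t : ℝ in 𝓝 0, HasDerivAt (fun t : ℝ => u (z + t * v))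
      (fderiv ℝ u (z + t * v) v) t := by
    have : ∀ᶠ w in 𝓝 z, DifferentiableAt ℝ u w := by
      filter_upwards [hu.eventually (by simp)] with w hw
      exact hw.differentiableAt (by simp)
    filter_upwards [hcont.eventually this] with t ht
    exact ht.hasFDerivAt.comp_hasDerivAt t (hline t)
  have h2 : deriv (fun t : ℝ => u (z + t * v)) =ᶠ[𝓝 0] fun t => fderiv ℝ u (z + t * v) v :=
    h1.mono fun t ht => ht.deriv
  have hdd : DifferentiableAt ℝ (fderiv ℝ u) z :=
    (hu.fderiv_right (m := 1) (by norm_num)).differentiableAt (by simp)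
  have h3 : HasDerivAt (fun t : ℝ => fderiv ℝ u (z + t * v)) (fderiv ℝ (fderiv ℝ u) z v) 0 := by
    have h4 : HasFDerivAt (fderiv ℝ u) (fderiv ℝ (fderiv ℝ u) z) (z + ((0 : ℝ) : ℂ) * v) := by
      rw [hz]; exact hdd.hasFDerivAt
    exact h4.comp_hasDerivAt (0 : ℝ) (hline 0)
  have h5 : HasDerivAt (fun t : ℝ => fderiv ℝ u (z + t * v) v) (fderiv ℝ (fderiv ℝ u) z v v) 0 := by
    simpa using h3.clm_apply (hasDerivAt_const (0 : ℝ) v)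
  have h6 : IsLocalMax (fun t : ℝ => u (z + t * v)) 0 := by
    have := hcont.eventually hmax
    simpa [IsLocalMax, IsMaxFilter] using this
  have h7 := IsLocalMax.deriv_deriv_nonpos h6 h1.self_of_nhds.continuousAt
  rw [h2.deriv_eq, h5.deriv] at h7
  simpa [iteratedFDeriv_two_apply] using h7

theorem IsLocalMax.laplacian_nonpos {u : ℂ → ℝ} {z : ℂ} (hu : ContDiffAt ℝ 2 u z)
    (hmax : IsLocalMax u z) : Laplacian.laplacian u z ≤ 0 := by
  rw [InnerProductSpace.laplacian_eq_iteratedFDeriv_complexPlane]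
  exact add_nonpos (IsLocalMax.iteratedFDeriv_two_nonpos hu hmax _)
    (IsLocalMax.iteratedFDeriv_two_nonpos hu hmax _)

theorem contDiffAt_log_sub_norm_sq {s : ℝ} {z : ℂ} (hz : ‖z‖ ^ 2 < s) :
    ContDiffAt ℝ ∞ (fun w : ℂ => Real.log (s - ‖w‖ ^ 2)) z :=
  ContDiffAt.log (contDiffAt_const.sub (contDiff_norm_sq ℝ).contDiffAt) (by linarith)

/-- The Laplacian of `log (s - |z|²)`. -/
theorem laplacian_log_sub_norm_sq {s : ℝ} {z : ℂ} (hz : ‖z‖ ^ 2 < s) :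
    Laplacian.laplacian (fun w : ℂ => Real.log (s - ‖w‖ ^ 2)) z = -4 * s / (s - ‖z‖ ^ 2) ^ 2 := by
  have hcast : ∀ w : ℂ, (s - w * conj w : ℂ) = ((s - ‖w‖ ^ 2 : ℝ) : ℂ) := fun w => by
    push_cast; rw [mul_conj']
  have hev : ∀ᶠ w : ℂ in 𝓝 z, ‖w‖ ^ 2 < s :=
    (continuous_norm.pow 2).continuousAt.eventually_lt continuousAt_const hz
  have hid : ∀ w : ℂ, HasWirtingerAt (fun w => w) 1 0 w := fun w =>
    hasWirtingerAt_of_hasDerivAt (hasDerivAt_id w)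
  have hq : ∀ w : ℂ, HasWirtingerAt (fun w => (s - w * conj w : ℂ)) (-conj w) (-w) w := fun w =>
    ((hasWirtingerAt_const (s : ℂ)).sub ((hid w).mul (hid w).conj)).congr (by simp) (by simp)
  have h1 : ∀ᶠ w : ℂ in 𝓝 z, HasWirtingerAt (fun w => ((Real.log (s - ‖w‖ ^ 2) : ℝ) : ℂ))
      ((s - w * conj w)⁻¹ * -conj w) ((s - w * conj w)⁻¹ * -w) w := by
    filter_upwards [hev.eventually_nhds] with w hw
    have hw0 := hw.self_of_nhds
    have h2 : HasDerivAt Complex.log (s - w * conj w)⁻¹ (s - w * conj w) := by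
      apply Complex.hasDerivAt_log
      rw [hcast]
      exact Complex.ofReal_mem_slitPlane.2 (by linarith)
    refine (HasWirtingerAt.comp_left (F := fun w => (s - w * conj w : ℂ)) h2 (hq w)).congr_of_eventuallyEq ?_
    filter_upwards [hw] with y hy
    rw [hcast, Complex.ofReal_log (by linarith)]
  have hz0 : (s - z * conj z : ℂ) ≠ 0 := by
    rw [hcast]; exact_mod_cast (by linarith : s - ‖z‖ ^ 2 ≠ 0)
  have hinv := HasWirtingerAt.comp_left (F := fun w => (s - w * conj w : ℂ)) (hasDerivAt_inv hz0)
    (hq z)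
  have hA := hinv.mul (HasWirtingerAt.comp_left (hasDerivAt_neg' (conj z)) (hid z).conj)
  have hB := hinv.mul (HasWirtingerAt.comp_left (hasDerivAt_neg' z) (hid z))
  have := HasWirtingerAt.laplacian ((contDiffAt_log_sub_norm_sq hz).of_le two_le_infty) h1 hA hB
  have h3 : ((Laplacian.laplacian (fun w : ℂ => Real.log (s - ‖w‖ ^ 2)) z : ℝ) : ℂ) =
      ((-4 * s / (s - ‖z‖ ^ 2) ^ 2 : ℝ) : ℂ) := by
    rw [this]
    rw [Complex.ofReal_div, Complex.ofReal_pow, ← hcast]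
    simp only [map_one, Complex.ofReal_mul, Complex.ofReal_neg, Complex.ofReal_ofNat]
    field_simp
    ring
  exact_mod_cast h3

/-- A subsolution of the system on the Poincaré disc is nonpositive at the origin. -/
theorem subsolution_disc_nonpos {n : ℕ} {V : ℕ → ℂ → ℝ}
    (hV0 : ∀ z, V 0 z = 0) (hVn : ∀ z, V n z = 0)
    (hVs : ∀ i, 1 ≤ i → i < n → ∀ z ∈ ball (0 : ℂ) 1, ContDiffAt ℝ ∞ (V i) z)
    (hV : ∀ i, 1 ≤ i → i < n → ∀ z ∈ ball (0 : ℂ) 1,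
      poincareDensity z * ((i : ℝ) * ((n : ℝ) - i) *
        (Real.exp (2 * V i z - V (i - 1) z - V (i + 1) z) - 1)) ≤ Laplacian.laplacian (V i) z)
    {i : ℕ} (hi : 1 ≤ i) (hin : i < n) : V i 0 ≤ 0 := by
  set c : ℕ → ℝ := fun i => (i : ℝ) * ((n : ℝ) - i) with hc
  have hcpos : ∀ i, 1 ≤ i → i < n → 0 < c i := fun i h1 h2 => by
    have h3 : (0 : ℝ) < i := by exact_mod_cast h1
    have h4 : (i : ℝ) < n := by exact_mod_cast h2
    exact mul_pos h3 (by linarith)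
  have main : ∀ r : ℝ, 0 < r → r < 1 → ∀ i, 1 ≤ i → i < n → r * Real.exp (V i 0 / c i) ≤ 1 := by
    intro r hr0 hr1
    -- The first factor is the square root of the ratio of the Poincaré density of the unit disc to
    -- that of the disc of radius `r`. It vanishes on `‖z‖ = r`, which keeps the maximum inside when
    -- it exceeds `1`, and equals `r` at the origin.
    set F : ℕ → ℂ → ℝ := fun i z =>
      (r ^ 2 - ‖z‖ ^ 2) / (r * (1 - ‖z‖ ^ 2)) * Real.exp (V i z / c i) with hF
    have hK1 : ∀ z ∈ closedBall (0 : ℂ) r, ‖z‖ < 1 := fun z hz => by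
      have : ‖z‖ ≤ r := by simpa using hz
      linarith
    have hcont : ∀ i, 1 ≤ i → i < n → ContinuousOn (F i) (closedBall 0 r) := by
      intro i h1 h2 z hz
      have h3 := one_sub_sq_pos (hK1 z hz)
      have h4 : ContinuousAt (V i) z := (hVs i h1 h2 z (by simpa using hK1 z hz)).continuousAt
      have h5 : ContinuousAt (fun z : ℂ => ‖z‖) z := continuous_norm.continuousAt
      refine ContinuousAt.continuousWithinAt ?_
      exact ((continuousAt_const.sub (h5.pow 2)).div
        (continuousAt_const.mul (continuousAt_const.sub (h5.pow 2)))
        (mul_pos hr0 h3).ne').mul (h4.div_const _).rexp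
    have hmaxi : ∀ i, ∃ z, 1 ≤ i → i < n → z ∈ closedBall (0 : ℂ) r ∧
        ∀ w ∈ closedBall (0 : ℂ) r, F i w ≤ F i z := by
      intro i
      by_cases h : 1 ≤ i ∧ i < n
      · obtain ⟨z, hz, hmax⟩ := (isCompact_closedBall (0 : ℂ) r).exists_isMaxOn
          ⟨0, by simp [hr0.le]⟩ (hcont i h.1 h.2)
        exact ⟨z, fun _ _ => ⟨hz, fun w hw => hmax hw⟩⟩
      · exact ⟨0, fun h1 h2 => absurd ⟨h1, h2⟩ h⟩
    choose ζ hζ using hmaxi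
    obtain ⟨i, hiI, hmax⟩ := (Finset.Ico 1 n).exists_max_image (fun i => F i (ζ i))
      ⟨i, Finset.mem_Ico.2 ⟨hi, hin⟩⟩
    obtain ⟨h1, h2⟩ := Finset.mem_Ico.1 hiI
    set z := ζ i with hz
    have hall : ∀ j, 1 ≤ j → j < n → ∀ w ∈ closedBall (0 : ℂ) r, F j w ≤ F i z :=
      fun j hj hjn w hw => ((hζ j hj hjn).2 w hw).trans (hmax j (Finset.mem_Ico.2 ⟨hj, hjn⟩))
    suffices hle : F i z ≤ 1 by
      intro j hj hjn
      have h3 := (hall j hj hjn 0 (by simp [hr0.le])).trans hle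
      simp only [hF, norm_zero] at h3
      rwa [show (r ^ 2 - 0 ^ 2) / (r * (1 - 0 ^ 2)) = r by
        rw [div_eq_iff (by simpa using hr0.ne')]; ring] at h3
    by_contra! hgt
    have hzr : ‖z‖ ≤ r := by simpa using (hζ i h1 h2).1
    have hzr' : ‖z‖ < r := by
      rcases hzr.lt_or_eq with h | h
      · exact h
      · exfalso
        simp only [hF, h, sub_self, zero_div, zero_mul] at hgt
        linarith
    have hsq : ∀ w : ℂ, ‖w‖ < r → ‖w‖ ^ 2 < r ^ 2 := fun w hw =>
      pow_lt_pow_left₀ hw (norm_nonneg _) two_ne_zero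
    have hz1 : z ∈ ball (0 : ℂ) 1 := by simpa using hzr'.trans hr1
    set H : ℕ → ℂ → ℝ := fun j w => V j w / c j + Real.log (r ^ 2 - ‖w‖ ^ 2)
      - Real.log (1 - ‖w‖ ^ 2) with hH
    have hFH : ∀ j, ∀ w : ℂ, ‖w‖ < r → F j w = Real.exp (H j w) / r := by
      intro j w hw
      have e1 : 0 < r ^ 2 - ‖w‖ ^ 2 := by linarith [hsq w hw]
      have e2 := one_sub_sq_pos (hw.trans hr1)
      simp only [hF, hH]
      rw [Real.exp_sub, Real.exp_add, Real.exp_log e1, Real.exp_log e2]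
      field_simp
    have hHle : ∀ j, 1 ≤ j → j < n → ∀ w : ℂ, ‖w‖ < r → H j w ≤ H i z := by
      intro j hj hjn w hw
      have := hall j hj hjn w (by simpa using hw.le)
      rw [hFH j w hw, hFH i z hzr', div_le_div_iff_of_pos_right hr0, Real.exp_le_exp] at this
      exact this
    have hloc : IsLocalMax (H i) z := by
      have : ∀ᶠ w : ℂ in 𝓝 z, ‖w‖ < r :=
        continuous_norm.continuousAt.eventually_lt continuousAt_const hzr'
      filter_upwards [this] with w hw using hHle i h1 h2 w hw
    set M := V i z / c i with hM
    have hci := hcpos i h1 h2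
    have hVM : V i z = c i * M := by rw [hM]; field_simp
    -- The logarithmic terms of `H j` do not depend on `j`, so maximality over the index compares `V
    -- j / c j` with `M`. At `j = 0` and `j = n` both sides vanish.
    have hother : ∀ j, j ≤ n → V j z ≤ c j * M := by
      intro j hj
      rcases Nat.eq_zero_or_pos j with rfl | hj0
      · simp [hV0, hc]
      rcases hj.lt_or_eq with hj' | rfl
      · have := hHle j hj0 hj' z hzr'
        simp only [hH] at this
        have h3 : V j z / c j ≤ M := by linarith
        rwa [div_le_iff₀' (hcpos j hj0 hj')] at h3
      · simp [hVn, hc]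
    have hexp : 2 * M ≤ 2 * V i z - V (i - 1) z - V (i + 1) z := by
      have e1 := hother (i - 1) (by omega)
      have e2 := hother (i + 1) (by omega)
      have e3 : 2 * c i - c (i - 1) - c (i + 1) = 2 := by
        simp only [hc]
        push_cast [Nat.cast_sub h1]
        ring
      have e4 : (2 * c i - c (i - 1) - c (i + 1)) * M = 2 * M := by rw [e3]
      linarith
    have hP : 0 < poincareDensity z := by
      have := one_sub_sq_pos (hzr'.trans hr1)
      unfold poincareDensity
      positivity
    have hlapV : c i * (poincareDensity z * (Real.exp (2 * M) - 1)) ≤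
        Laplacian.laplacian (V i) z := by
      refine le_trans ?_ (hV i h1 h2 z hz1)
      have := Real.exp_le_exp.2 hexp
      have h3 : c i * (poincareDensity z * (Real.exp (2 * M) - 1)) =
        poincareDensity z * (c i * (Real.exp (2 * M) - 1)) := by ring
      rw [h3]
      gcongr
    have hs1 : ContDiffAt ℝ 2 (fun w => V i w / c i) z :=
      ((hVs i h1 h2 z hz1).div_const _).of_le two_le_infty
    have hs2 : ContDiffAt ℝ 2 (fun w : ℂ => Real.log (r ^ 2 - ‖w‖ ^ 2)) z :=
      (contDiffAt_log_sub_norm_sq (hsq z hzr')).of_le two_le_infty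
    have hz1sq : ‖z‖ ^ 2 < 1 := by linarith [one_sub_sq_pos (hzr'.trans hr1)]
    have hs3 : ContDiffAt ℝ 2 (fun w : ℂ => Real.log (1 - ‖w‖ ^ 2)) z :=
      (contDiffAt_log_sub_norm_sq hz1sq).of_le two_le_infty
    have hlapH : Laplacian.laplacian (H i) z = Laplacian.laplacian (V i) z / c i +
        -4 * r ^ 2 / (r ^ 2 - ‖z‖ ^ 2) ^ 2 - -4 * 1 / (1 - ‖z‖ ^ 2) ^ 2 := by
      have e0 : H i = ((fun w => V i w / c i) + fun w : ℂ => Real.log (r ^ 2 - ‖w‖ ^ 2)) -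
        fun w : ℂ => Real.log (1 - ‖w‖ ^ 2) := rfl
      have hs12 : ContDiffAt ℝ 2
          ((fun w => V i w / c i) + fun w : ℂ => Real.log (r ^ 2 - ‖w‖ ^ 2)) z := hs1.add hs2
      rw [e0, hs12.laplacian_sub hs3, hs1.laplacian_add hs2,
        laplacian_log_sub_norm_sq (hsq z hzr'), laplacian_log_sub_norm_sq hz1sq]
      have e1 : (fun w => V i w / c i) = (c i)⁻¹ • V i := by
        ext w; simp [div_eq_inv_mul]
      rw [e1, InnerProductSpace.laplacian_smul _ ((hVs i h1 h2 z hz1).of_le two_le_infty),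
        smul_eq_mul, ← div_eq_inv_mul]
    have hnp := IsLocalMax.laplacian_nonpos ((hs1.add hs2).sub hs3) hloc
    rw [hlapH] at hnp
    have h3 : poincareDensity z * (Real.exp (2 * M) - 1) ≤ Laplacian.laplacian (V i) z / c i := by
      rwa [le_div_iff₀' hci]
    have e1 : 0 < r ^ 2 - ‖z‖ ^ 2 := by linarith [hsq z hzr']
    have e2 := one_sub_sq_pos (hzr'.trans hr1)
    -- `F i z > 1` makes `P exp (2 M)` exceed the density of the disc of radius `r`, while `Δ (H i)
    -- ≤ 0` says that it does not.
    have h4 : r * (1 - ‖z‖ ^ 2) / (r ^ 2 - ‖z‖ ^ 2) < Real.exp M := by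
      simp only [hF] at hgt
      rw [div_mul_eq_mul_div, one_lt_div (by positivity)] at hgt
      rwa [div_lt_iff₀' e1]
    have h5 : (r * (1 - ‖z‖ ^ 2) / (r ^ 2 - ‖z‖ ^ 2)) ^ 2 < Real.exp (2 * M) := by
      rw [show (2 : ℝ) * M = (2 : ℕ) * M by norm_num, Real.exp_nat_mul]
      exact pow_lt_pow_left₀ h4 (by positivity) two_ne_zero
    have h6 : poincareDensity z * ((r * (1 - ‖z‖ ^ 2) / (r ^ 2 - ‖z‖ ^ 2)) ^ 2 - 1) <
        poincareDensity z * (Real.exp (2 * M) - 1) := by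
      gcongr
    have h7 : poincareDensity z * ((r * (1 - ‖z‖ ^ 2) / (r ^ 2 - ‖z‖ ^ 2)) ^ 2 - 1) =
        4 * r ^ 2 / (r ^ 2 - ‖z‖ ^ 2) ^ 2 - 4 * 1 / (1 - ‖z‖ ^ 2) ^ 2 := by
      unfold poincareDensity
      field_simp
    rw [neg_mul, neg_div, neg_mul, neg_div] at hnp
    linarith
  by_contra! hpos
  set x := V i 0 / c i with hx
  have hx0 : 0 < x := div_pos hpos (hcpos i hi hin)
  -- With this radius the bound reads `exp (x / 2) ≤ 1`, contradicting `x > 0`.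
  have := main (Real.exp (-(x / 2))) (Real.exp_pos _) (by rw [Real.exp_lt_one_iff]; linarith) i hi hin
  rw [← hx, ← Real.exp_add, Real.exp_le_one_iff] at this
  linarith

end MaximumPrinciple

/-! ### Local isometries from the disc to the surface, read in charts. -/

section Interface

open Complex Filter Topology ComplexConjugate Metric Set

variable {X : Type*} [TopologicalSpace X] [ChartedSpace ℂ X] [IsManifold 𝓘(ℂ, ℂ) ω X]

variable [RiemannianBundle (fun x : X => TangentSpace 𝓘(ℝ, ℂ) x)]

/-- The map `φ` from the Poincaré disc to `X` is holomorphic at `z`, and its differential at `z`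
is an isometry. -/
structure LocIsometryAt (φ : ℂ → X) (z : ℂ) : Prop where
  mdifferentiableAt : MDifferentiableAt 𝓘(ℂ, ℂ) 𝓘(ℂ, ℂ) φ z
  mdifferentiableAt_real : MDifferentiableAt 𝓘(ℝ, ℂ) 𝓘(ℝ, ℂ) φ z
  norm_mfderiv : ∀ w : ℂ,
    ‖mfderiv 𝓘(ℝ, ℂ) 𝓘(ℝ, ℂ) φ z w‖ ^ 2 = poincareDensity z * ‖w‖ ^ 2

theorem norm_mfderiv_symm_comp (hX : IsHyperbolicMetric X) {e : OpenPartialHomeomorph X ℂ}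
    (he : e ∈ atlas ℂ X) {h : ℂ → ℂ} {z : ℂ} (hh : DifferentiableAt ℂ h z)
    (hz : h z ∈ e.target) :
    MDifferentiableAt 𝓘(ℝ, ℂ) 𝓘(ℝ, ℂ) (e.symm ∘ h) z ∧
    ∀ w : ℂ, ‖mfderiv 𝓘(ℝ, ℂ) 𝓘(ℝ, ℂ) (e.symm ∘ h) z w‖ ^ 2 =
      density e (h z) * ‖deriv h z‖ ^ 2 * ‖w‖ ^ 2 := by
  have h1 : MDifferentiableAt 𝓘(ℝ, ℂ) 𝓘(ℝ, ℂ) e.symm (h z) := mdifferentiableAt_atlas_symm he hz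
  have h2 : HasFDerivAt h ((fderiv ℂ h z).restrictScalars ℝ) z :=
    hh.hasFDerivAt.restrictScalars ℝ
  have h3 : HasMFDerivAt 𝓘(ℝ, ℂ) 𝓘(ℝ, ℂ) h z ((fderiv ℂ h z).restrictScalars ℝ) :=
    h2.hasMFDerivAt
  have h4 := h1.hasMFDerivAt.comp z h3
  refine ⟨h4.mdifferentiableAt, fun w => ?_⟩
  rw [h4.mfderiv]
  have h5 := hX.conformal e he (h z) hz (fderiv ℂ h z w)
  refine h5.trans ?_
  have h6 : fderiv ℂ h z w = w * deriv h z := by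
    rw [← smul_eq_mul, ← fderiv_apply_one_eq_deriv, ← map_smul, smul_eq_mul, mul_one]
  rw [h6, norm_mul]
  ring

theorem locIsometryAt_symm_comp (hX : IsHyperbolicMetric X) {e : OpenPartialHomeomorph X ℂ}
    (he : e ∈ atlas ℂ X) {h : ℂ → ℂ} {z : ℂ} (hh : DifferentiableAt ℂ h z)
    (hz : h z ∈ e.target) (hd : density e (h z) * ‖deriv h z‖ ^ 2 = poincareDensity z) :
    LocIsometryAt (e.symm ∘ h) z := by
  obtain ⟨h1, h2⟩ := norm_mfderiv_symm_comp hX he hh hz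
  refine ⟨?_, h1, fun w => by rw [h2, hd]⟩
  exact (mdifferentiableAt_atlas_symm he hz).comp z hh.mdifferentiableAt

omit [IsManifold 𝓘(ℂ, ℂ) ω X] in
theorem norm_mfderiv_congr {φ ψ : ℂ → X} {z : ℂ} (h : ψ =ᶠ[𝓝 z] φ) (w : ℂ) :
    ‖mfderiv 𝓘(ℝ, ℂ) 𝓘(ℝ, ℂ) ψ z w‖ = ‖mfderiv 𝓘(ℝ, ℂ) 𝓘(ℝ, ℂ) φ z w‖ := by
  -- The two vectors live in fibres over `ψ z` and `φ z`. Treating the norm as a function of base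
  -- point and of a vector in `ℂ` lets both arguments be rewritten at once.
  let N : X → ℂ → ℝ := fun x v => @norm (TangentSpace 𝓘(ℝ, ℂ) x) _ v
  have h1 : (mfderiv 𝓘(ℝ, ℂ) 𝓘(ℝ, ℂ) ψ z w : ℂ) = mfderiv 𝓘(ℝ, ℂ) 𝓘(ℝ, ℂ) φ z w :=
    congrArg (fun L : ℂ →L[ℝ] ℂ => L w) h.mfderiv_eq
  exact congrArg₂ N h.eq_of_nhds h1

omit [IsManifold 𝓘(ℂ, ℂ) ω X] in
theorem LocIsometryAt.congr {φ ψ : ℂ → X} {z : ℂ} (hφ : LocIsometryAt φ z) (h : ψ =ᶠ[𝓝 z] φ) :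
    LocIsometryAt ψ z :=
  ⟨hφ.1.congr_of_eventuallyEq h, hφ.2.congr_of_eventuallyEq h, fun w => by
    rw [norm_mfderiv_congr h w, hφ.3 w]⟩

omit [IsManifold 𝓘(ℂ, ℂ) ω X] in
theorem LocIsometryAt.continuousAt {φ : ℂ → X} {z : ℂ} (hφ : LocIsometryAt φ z) :
    ContinuousAt φ z := hφ.1.continuousAt

theorem LocIsometryAt.chart_comp (hX : IsHyperbolicMetric X) {φ : ℂ → X} {z : ℂ}
    (hφ : LocIsometryAt φ z) {e : OpenPartialHomeomorph X ℂ}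
    (he : e ∈ atlas ℂ X) (hz : φ z ∈ e.source) :
    DifferentiableAt ℂ (e ∘ φ) z ∧
      density e (e (φ z)) * ‖deriv (e ∘ φ) z‖ ^ 2 = poincareDensity z := by
  have h1 : DifferentiableAt ℂ (e ∘ φ) z :=
    ((mdifferentiableAt_atlas he hz).comp z hφ.1).differentiableAt
  refine ⟨h1, ?_⟩
  have h2 : φ =ᶠ[𝓝 z] e.symm ∘ (e ∘ φ) := by
    filter_upwards [hφ.continuousAt.preimage_mem_nhds (e.open_source.mem_nhds hz)] with w hw
    exact (e.left_inv hw).symm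
  have hz' : (e ∘ φ) z ∈ e.target := e.map_source hz
  have h3 := (norm_mfderiv_symm_comp hX he h1 hz').2 1
  rw [← norm_mfderiv_congr h2, hφ.3 1] at h3
  simpa using h3.symm

omit [IsManifold 𝓘(ℂ, ℂ) ω X] in
theorem LocIsometryAt.comp {φ : ℂ → X} {h : ℂ → ℂ} {z : ℂ} (hz : ‖z‖ < 1)
    (hφ : LocIsometryAt φ (h z)) (hh : HypIsometryAt h z) : LocIsometryAt (φ ∘ h) z := by
  have h2 : HasFDerivAt h ((fderiv ℂ h z).restrictScalars ℝ) z :=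
    hh.1.hasFDerivAt.restrictScalars ℝ
  have h3 : HasMFDerivAt 𝓘(ℝ, ℂ) 𝓘(ℝ, ℂ) h z ((fderiv ℂ h z).restrictScalars ℝ) :=
    h2.hasMFDerivAt
  have h4 := hφ.2.hasMFDerivAt.comp z h3
  refine ⟨hφ.1.comp z hh.1.mdifferentiableAt, h4.mdifferentiableAt, fun w => ?_⟩
  rw [h4.mfderiv]
  have h5 := hφ.3 (fderiv ℂ h z w)
  refine h5.trans ?_
  have h6 : fderiv ℂ h z w = w * deriv h z := by
    rw [← smul_eq_mul, ← fderiv_apply_one_eq_deriv, ← map_smul, smul_eq_mul, mul_one]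
  have h7 := one_sub_sq_pos hz
  have h8 := one_sub_sq_pos hh.2
  rw [h6, norm_mul, poincareDensity, poincareDensity, ← hh.3]
  have h9 : ‖deriv h z‖ ≠ 0 := by
    intro h0
    have := hh.3
    rw [h0] at this
    linarith
  field_simp


/-- A local isometry pulls back the differential operators of `X` to those of the disc. -/
theorem LocIsometryAt.laplacian_comp (hX : IsHyperbolicMetric X) {φ : ℂ → X} {z : ℂ}
    (hφ : ∀ᶠ w in 𝓝 z, LocIsometryAt φ w) {e : OpenPartialHomeomorph X ℂ} (he : e ∈ atlas ℂ X)
    (hz : φ z ∈ e.source) (hP : 0 < poincareDensity z) {v : X → ℝ}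
    (hv : ContMDiff 𝓘(ℝ, ℂ) 𝓘(ℝ, ℝ) ∞ v) :
    ContDiffAt ℝ ∞ (fun w => v (φ w)) z ∧
      Laplacian.laplacian (fun w => v (φ w)) z =
        poincareDensity z * laplaceBeltrami e v (e (φ z)) := by
  have hφz := hφ.self_of_nhds
  have hsrc : ∀ᶠ w in 𝓝 z, φ w ∈ e.source :=
    hφz.continuousAt.preimage_mem_nhds (e.open_source.mem_nhds hz)
  have h2 : (fun w => v (φ w)) =ᶠ[𝓝 z] fun w => (fun ζ : ℂ => v (e.symm ζ)) ((e ∘ φ) w) := by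
    filter_upwards [hsrc] with w hw
    simp [e.left_inv hw]
  have hz' : e (φ z) ∈ e.target := e.map_source hz
  have hhol : ∀ᶠ w in 𝓝 z, DifferentiableAt ℂ (e ∘ φ) w := by
    filter_upwards [hφ, hsrc] with w hw hw'
    exact (hw.chart_comp hX he hw').1
  have hvs : ContDiffAt ℝ ∞ (fun ζ : ℂ => v (e.symm ζ)) (e (φ z)) := by
    have h3 : ContMDiffAt 𝓘(ℝ, ℂ) 𝓘(ℝ, ℂ) ∞ e.symm (e (φ z)) :=
      contMDiffAt_symm_of_mem_maximalAtlas (IsManifold.subset_maximalAtlas he) hz'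
    exact (hv.contMDiffAt.comp _ h3).contDiffAt
  have han : AnalyticAt ℂ (e ∘ φ) z := analyticAt_iff_eventually_differentiableAt.2 hhol
  have hcs : ContDiffAt ℝ ∞ (e ∘ φ) z := (han.contDiffAt (n := ∞)).restrict_scalars ℝ
  refine ⟨(ContDiffAt.comp z (g := fun ζ : ℂ => v (e.symm ζ)) hvs hcs).congr_of_eventuallyEq h2, ?_⟩
  rw [(InnerProductSpace.laplacian_congr_nhds h2).eq_of_nhds,
    laplacian_comp_holomorphic (h := e ∘ φ) hvs hhol, laplaceBeltrami]
  have h5 := (hφz.chart_comp hX he hz).2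
  have h6 : density e (e (φ z)) ≠ 0 := by
    intro h0
    rw [h0, zero_mul] at h5
    exact hP.ne h5
  rw [← h5]
  simp only [Function.comp_apply]
  field_simp

/-- The density of the metric is positive. -/
theorem density_pos {e : OpenPartialHomeomorph X ℂ} (he : e ∈ atlas ℂ X) {z : ℂ}
    (hz : z ∈ e.target) : 0 < density e z := by
  have h1 : MDifferentiableAt 𝓘(ℝ, ℂ) 𝓘(ℝ, ℂ) e.symm z := mdifferentiableAt_atlas_symm he hz
  have h2 := (mdifferentiable_of_mem_atlas (I := 𝓘(ℝ, ℂ)) he).symm.mfderiv_injective (x := z) hz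
  unfold density
  have h3 : mfderiv 𝓘(ℝ, ℂ) 𝓘(ℝ, ℂ) e.symm z (1 : ℂ) ≠ 0 := by
    intro h0
    have := h2 (h0.trans (map_zero _).symm)
    exact one_ne_zero (α := ℂ) this
  have := norm_pos_iff.2 h3
  positivity

/-- The density of the metric is smooth. -/
theorem contDiffAt_density
    [IsContMDiffRiemannianBundle 𝓘(ℝ, ℂ) ∞ ℂ (fun x : X => TangentSpace 𝓘(ℝ, ℂ) x)]
    {e : OpenPartialHomeomorph X ℂ} (he : e ∈ atlas ℂ X) {z : ℂ}
    (hz : z ∈ e.target) : ContDiffAt ℝ ∞ (density e) z := by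
  have h3 : ContMDiffOn 𝓘(ℝ, ℂ) 𝓘(ℝ, ℂ) ω e.symm e.target :=
    contMDiffOn_symm_of_mem_maximalAtlas (IsManifold.subset_maximalAtlas he)
  -- The tangent map of `e.symm` sends the constant field `1` to a smooth section along `e.symm`;
  -- the density is its squared length, hence smooth.
  have h4 := h3.contMDiffOn_tangentMapWithin (m := ∞) (by simp) e.open_target.uniqueMDiffOn
  have h5 : ContMDiff 𝓘(ℝ, ℂ) 𝓘(ℝ, ℂ).tangent ∞
      (fun w : ℂ => (⟨w, (1 : ℂ)⟩ : TangentBundle 𝓘(ℝ, ℂ) ℂ)) :=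
    contMDiff_vectorSpace_iff_contDiff.2 contDiff_const
  have h6 : ContMDiffOn 𝓘(ℝ, ℂ) (𝓘(ℝ, ℂ).prod 𝓘(ℝ, ℂ)) ∞
      (fun w : ℂ => (⟨e.symm w, mfderivWithin 𝓘(ℝ, ℂ) 𝓘(ℝ, ℂ) e.symm e.target w (1 : ℂ)⟩ :
        TotalSpace ℂ (fun x : X => TangentSpace 𝓘(ℝ, ℂ) x))) e.target :=
    h4.comp h5.contMDiffOn (fun w hw => hw)
  have h7 := h6.inner_bundle h6
  refine (h7.contDiffOn.contDiffAt (e.open_target.mem_nhds hz)).congr_of_eventuallyEq ?_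
  filter_upwards [e.open_target.mem_nhds hz] with w hw
  rw [mfderivWithin_of_isOpen e.open_target hw]
  exact (real_inner_self_eq_norm_sq _).symm

end Interface

/-! ### Local isometric coordinates and the identity theorem. -/

section LocalInverse

open Complex Filter Topology ComplexConjugate Metric Set

variable {X : Type*} [TopologicalSpace X] [ChartedSpace ℂ X] [IsManifold 𝓘(ℂ, ℂ) ω X]
  [RiemannianBundle (fun x : X => TangentSpace 𝓘(ℝ, ℂ) x)]

/-- Near each of its points, a hyperbolic surface is isometric to a neighbourhood of the origin
in the Poincaré disc. -/
theorem exists_local_isometry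
    [IsContMDiffRiemannianBundle 𝓘(ℝ, ℂ) ∞ ℂ (fun x : X => TangentSpace 𝓘(ℝ, ℂ) x)]
    (hX : IsHyperbolicMetric X) (q : X) :
    ∃ s : ℝ, 0 < s ∧ s ≤ 1 ∧ ∃ (χ : ℂ → X) (f : X → ℂ) (V : Set X), IsOpen V ∧ q ∈ V ∧ f q = 0 ∧
      ContinuousAt f q ∧ (∀ z ∈ ball (0 : ℂ) s, LocIsometryAt χ z) ∧
      (∀ x ∈ V, f x ∈ ball (0 : ℂ) s ∧ χ (f x) = x) ∧
      ∀ (φ : ℂ → X) (z : ℂ), ‖z‖ < 1 → LocIsometryAt φ z → φ z ∈ V → HypIsometryAt (f ∘ φ) z := by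
  set e := chartAt ℂ q with he
  have hea : e ∈ atlas ℂ X := chart_mem_atlas ℂ q
  have hq : q ∈ e.source := mem_chart_source ℂ q
  obtain ⟨R, hR, hRe⟩ := Metric.isOpen_iff.1 e.open_target (e q) (e.map_source hq)
  have hexp : ∀ z ∈ e.target, Real.exp (Real.log (density e z)) = density e z := fun z hz =>
    Real.exp_log (density_pos hea hz)
  -- With `u = log density`, curvature `-1` is the Liouville equation `Δ u = 2 exp u`.
  obtain ⟨ε, hε, hεR, F, F', hF0, hF⟩ := exists_developing_map (u := fun z => Real.log (density e z))
    (z₀ := e q) hR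
    (fun z hz => (contDiffAt_density hea (hRe hz)).log (density_pos hea (hRe hz)).ne')
    (fun z hz => by
      have h1 := hX.curvature e hea z (hRe hz)
      have h2 := density_pos hea (hRe hz)
      rw [hexp z (hRe hz)]
      unfold gaussCurvature at h1
      field_simp at h1
      linarith)
  have hεe : ball (e q) ε ⊆ e.target := (ball_subset_ball hεR).trans hRe
  have hF'0 : ∀ z ∈ ball (e q) ε, F' z ≠ 0 := by
    intro z hz h0
    obtain ⟨-, h1, h2⟩ := hF z hz
    rw [h0, norm_zero] at h2
    have h3 := one_sub_sq_pos h1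
    have h4 := Real.exp_pos (Real.log (density e z))
    have : 0 < Real.exp (Real.log (density e z)) * (1 - ‖F z‖ ^ 2) ^ 2 := by positivity
    linarith
  have hz0 : e q ∈ ball (e q) ε := mem_ball_self hε
  have hFan : AnalyticAt ℂ F (e q) :=
    DifferentiableOn.analyticAt (fun z hz => (hF z hz).1.differentiableAt.differentiableWithinAt)
      (isOpen_ball.mem_nhds hz0)
  have hstrict : HasStrictDerivAt F (F' (e q)) (e q) := by
    have := hFan.hasStrictDerivAt
    rwa [(hF _ hz0).1.deriv] at this
  -- A local inverse of the developing map. The isometry is `e.symm ∘ P.symm`, with inverse `P ∘ e`.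
  set P := ((hstrict.hasStrictFDerivAt_equiv (hF'0 _ hz0)).toOpenPartialHomeomorph F).restrOpen
    (ball (e q) ε) isOpen_ball with hP
  have hPF : ∀ z, P z = F z := fun z => rfl
  have hPs : P.source ⊆ ball (e q) ε := by
    rw [hP, OpenPartialHomeomorph.restrOpen_source]; exact inter_subset_right
  have hqP : e q ∈ P.source := by
    rw [hP, OpenPartialHomeomorph.restrOpen_source]
    exact ⟨HasStrictFDerivAt.mem_toOpenPartialHomeomorph_source _, hz0⟩
  have h0P : (0 : ℂ) ∈ P.target := by
    rw [← hF0, ← hPF]; exact P.map_source hqP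
  obtain ⟨s, hs, hsP⟩ := Metric.isOpen_iff.1 P.open_target 0 h0P
  have hsP' : ball (0 : ℂ) (min s 1) ⊆ P.target := (ball_subset_ball (min_le_left _ _)).trans hsP
  refine ⟨min s 1, by positivity, min_le_right _ _, e.symm ∘ P.symm, P ∘ e,
    (e.trans P).source ∩ (e.trans P) ⁻¹' ball 0 (min s 1),
    (e.trans P).isOpen_inter_preimage isOpen_ball, ?_, ?_, ?_, ?_, ?_, ?_⟩
  · refine ⟨by simp [hq, hqP], ?_⟩
    simp only [mem_preimage, OpenPartialHomeomorph.coe_trans, Function.comp_apply, hPF, hF0]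
    exact mem_ball_self (by positivity)
  · simp only [Function.comp_apply, hPF, hF0]
  · exact (P.continuousAt hqP).comp (e.continuousAt hq)
  · intro w hw
    have hw' := hsP' hw
    have hζ := hPs (P.map_target hw')
    obtain ⟨h1, h2, h3⟩ := hF _ hζ
    have h4 : HasDerivAt P.symm (F' (P.symm w))⁻¹ w := P.hasDerivAt_symm hw' (hF'0 _ hζ) h1
    refine locIsometryAt_symm_comp hX hea h4.differentiableAt (hεe hζ) ?_
    have h5 : F (P.symm w) = w := P.right_inv hw'
    rw [hexp _ (hεe hζ), h5] at h3
    rw [h5] at h2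
    have h6 := one_sub_sq_pos h2
    have h7 : 0 < ‖F' (P.symm w)‖ := norm_pos_iff.2 (hF'0 _ hζ)
    rw [h4.deriv, norm_inv, poincareDensity]
    field_simp
    linarith
  · rintro x ⟨hx, hx2⟩
    refine ⟨hx2, ?_⟩
    exact (e.trans P).left_inv hx
  · rintro φ z hz hφ ⟨hx, -⟩
    rw [OpenPartialHomeomorph.trans_source] at hx
    obtain ⟨hx1, hx2⟩ := hx
    have hζ := hPs hx2
    obtain ⟨h1, h2, h3⟩ := hF _ hζ
    obtain ⟨d1, d2⟩ := hφ.chart_comp hX hea hx1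
    have hd : HasDerivAt (P ∘ e ∘ φ) (F' (e (φ z)) * deriv (e ∘ φ) z) z :=
      HasDerivAt.comp z (h₂ := F) h1 d1.hasDerivAt
    refine ⟨hd.differentiableAt, h2, ?_⟩
    change ‖deriv (P ∘ e ∘ φ) z‖ * _ = _
    rw [hd.deriv]
    have h6 := one_sub_sq_pos h2
    have h7 := one_sub_sq_pos hz
    rw [hexp _ (hεe hζ)] at h3
    refine (pow_left_inj₀ (by positivity) h6.le two_ne_zero).1 ?_
    unfold poincareDensity at d2
    have h8 : density e (e (φ z)) ≠ 0 := (density_pos hea (hεe hζ)).ne'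
    rw [norm_mul, mul_pow, mul_pow]
    rw [eq_div_iff (by positivity)] at d2
    have h9 : density e (e (φ z)) * (‖F' (e (φ z))‖ ^ 2 * ‖deriv (e ∘ φ) z‖ ^ 2 *
        (1 - ‖z‖ ^ 2) ^ 2) = density e (e (φ z)) * (1 - ‖F (e (φ z))‖ ^ 2) ^ 2 := by
      rw [h3]; linear_combination ‖F' (e (φ z))‖ ^ 2 * d2
    exact mul_left_cancel₀ h8 h9

omit [RiemannianBundle (fun x : X => TangentSpace 𝓘(ℝ, ℂ) x)] in
/-- The identity theorem for holomorphic maps from a plane domain to a Riemann surface. -/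
theorem eqOn_of_eventuallyEq [T2Space X] {φ ψ : ℂ → X} {U : Set ℂ} (hU : IsPreconnected U)
    (hφ : ∀ z ∈ U, ∀ᶠ w in 𝓝 z, MDifferentiableAt 𝓘(ℂ, ℂ) 𝓘(ℂ, ℂ) φ w)
    (hψ : ∀ z ∈ U, ∀ᶠ w in 𝓝 z, MDifferentiableAt 𝓘(ℂ, ℂ) 𝓘(ℂ, ℂ) ψ w)
    {z₀ : ℂ} (hz₀ : z₀ ∈ U) (h : φ =ᶠ[𝓝 z₀] ψ) : EqOn φ ψ U := by
  have hopen : IsOpen {z | φ =ᶠ[𝓝 z] ψ} := isOpen_setOfPred_eventually_nhds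
  have hsub : U ⊆ {z | φ =ᶠ[𝓝 z] ψ} := by
    refine hU.subset_of_closure_inter_subset hopen ⟨z₀, hz₀, h⟩ ?_
    rintro z ⟨hz, hzU⟩
    have hfreq : ∃ᶠ w in 𝓝 z, φ =ᶠ[𝓝 w] ψ := mem_closure_iff_frequently.1 hz
    have hcφ : ContinuousAt φ z := (hφ z hzU).self_of_nhds.continuousAt
    have hcψ : ContinuousAt ψ z := (hψ z hzU).self_of_nhds.continuousAt
    have hfe : ∃ᶠ w in 𝓝 z, φ w = ψ w := hfreq.mono fun w hw => hw.eq_of_nhds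
    have heq : φ z = ψ z := by
      by_contra hne
      exact hfe (((hcφ.prodMk hcψ).eventually ((isOpen_ne_fun continuous_fst continuous_snd).mem_nhds
        hne)).mono fun w hw => hw)
    set e := chartAt ℂ (φ z) with he
    have hea : e ∈ atlas ℂ X := chart_mem_atlas ℂ _
    have hs1 : ∀ᶠ w in 𝓝 z, φ w ∈ e.source :=
      hcφ.preimage_mem_nhds (e.open_source.mem_nhds (mem_chart_source ℂ _))
    have hs2 : ∀ᶠ w in 𝓝 z, ψ w ∈ e.source :=
      hcψ.preimage_mem_nhds (e.open_source.mem_nhds (heq ▸ mem_chart_source ℂ _))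
    have ha1 : AnalyticAt ℂ (e ∘ φ) z := by
      rw [analyticAt_iff_eventually_differentiableAt]
      filter_upwards [hφ z hzU, hs1] with w hw hw'
      exact ((mdifferentiableAt_atlas hea hw').comp w hw).differentiableAt
    have ha2 : AnalyticAt ℂ (e ∘ ψ) z := by
      rw [analyticAt_iff_eventually_differentiableAt]
      filter_upwards [hψ z hzU, hs2] with w hw hw'
      exact ((mdifferentiableAt_atlas hea hw').comp w hw).differentiableAt
    have hev : (e ∘ φ) =ᶠ[𝓝 z] (e ∘ ψ) := by
      rcases ha1.eventually_eq_or_eventually_ne ha2 with h1 | h1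
      · exact h1
      · exfalso
        -- If the germs differ, `φ` and `ψ` differ off `z` near `z`. Near a point `w` close to `z`
        -- where the germs agree, every point would then be `z`, but points of the plane are not
        -- isolated.
        rw [eventually_nhdsWithin_iff] at h1
        obtain ⟨w, hw1, hw2⟩ := (hfreq.and_eventually h1.eventually_nhds).exists
        have hw3 : ∀ᶠ y in 𝓝 w, y = z := by
          filter_upwards [hw1, hw2] with y hy1 hy2
          by_contra hne
          exact hy2 hne (congrArg e hy1)
        have h5 : ∃ᶠ y in 𝓝[≠] w, y ≠ w := Eventually.frequently eventually_mem_nhdsWithin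
        have h6 := hw3.self_of_nhds
        exact (h5.and_eventually (hw3.filter_mono nhdsWithin_le_nhds)).exists.elim
          fun y hy => hy.1 (hy.2.trans h6.symm)
    filter_upwards [hev, hs1, hs2] with w hw hw1 hw2
    exact e.injOn hw1 hw2 hw
  exact fun z hz => (hsub hz).eq_of_nhds

end LocalInverse

/-! ### Continuation of local isometries, using completeness. -/

section Continuation

open Complex Filter Topology ComplexConjugate Metric Set

variable {X : Type*} [MetricSpace X] [ChartedSpace ℂ X] [IsManifold 𝓘(ℂ, ℂ) ω X]
  [RiemannianBundle (fun x : X => TangentSpace 𝓘(ℝ, ℂ) x)]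

/-- In a chart `φ` is holomorphic near `z`, hence analytic. This upgrades pointwise
differentiability to the `C¹` regularity that lengths of curves require. -/
theorem contMDiffAt_of_locIsometryAt (hX : IsHyperbolicMetric X) {φ : ℂ → X} {z : ℂ}
    (hφ : ∀ᶠ w in 𝓝 z, LocIsometryAt φ w) : ContMDiffAt 𝓘(ℝ, ℂ) 𝓘(ℝ, ℂ) 1 φ z := by
  have hφz := hφ.self_of_nhds
  set e := chartAt ℂ (φ z) with he
  have hea : e ∈ atlas ℂ X := chart_mem_atlas ℂ _
  have hz : φ z ∈ e.source := mem_chart_source ℂ _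
  have hsrc : ∀ᶠ w in 𝓝 z, φ w ∈ e.source :=
    hφz.continuousAt.preimage_mem_nhds (e.open_source.mem_nhds hz)
  have han : AnalyticAt ℂ (e ∘ φ) z := by
    rw [analyticAt_iff_eventually_differentiableAt]
    filter_upwards [hφ, hsrc] with w hw hw'
    exact (hw.chart_comp hX hea hw').1
  have hcs : ContDiffAt ℝ 1 (e ∘ φ) z := (han.contDiffAt (n := 1)).restrict_scalars ℝ
  have h3 : ContMDiffAt 𝓘(ℝ, ℂ) 𝓘(ℝ, ℂ) 1 e.symm ((e ∘ φ) z) :=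
    contMDiffAt_symm_of_mem_maximalAtlas (IsManifold.subset_maximalAtlas hea) (e.map_source hz)
  refine (h3.comp z hcs.contMDiffAt).congr_of_eventuallyEq ?_
  filter_upwards [hsrc] with w hw
  exact (e.left_inv hw).symm

/-- A local isometry on a disc of radius `R < 1` is Lipschitz. -/
theorem lipschitzOnWith_of_locIsometryAt
    [IsRiemannianManifold 𝓘(ℝ, ℂ) X] (hX : IsHyperbolicMetric X)
    {φ : ℂ → X} {R : ℝ} (hR0 : 0 < R) (hR : R < 1) (hφ : ∀ z ∈ ball (0 : ℂ) R, LocIsometryAt φ z) :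
    LipschitzOnWith (Real.toNNReal (2 / (1 - R ^ 2))) φ (ball 0 R) := by
  intro a ha b hb
  have hpos : 0 < 1 - R ^ 2 := by nlinarith
  have hR2 : 0 ≤ 2 / (1 - R ^ 2) := by positivity
  rw [IsRiemannianManifold.out (I := 𝓘(ℝ, ℂ)) (φ a) (φ b)]
  set ℓ : ℝ → ℂ := fun t => a + t * (b - a) with hℓ
  have hℓd : ∀ t, HasDerivAt ℓ (b - a) t := fun t =>
    (((ofRealCLM.hasDerivAt (x := t)).mul_const (b - a)).const_add a).congr_deriv (by simp)
  have hmem : ∀ t ∈ Icc (0 : ℝ) 1, ℓ t ∈ ball (0 : ℂ) R := fun t ht => by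
    have := (convex_ball (0 : ℂ) R).add_smul_sub_mem ha hb ht
    simpa [hℓ] using this
  have hCM : ∀ t ∈ Icc (0 : ℝ) 1, ContMDiffAt 𝓘(ℝ, ℝ) 𝓘(ℝ, ℂ) 1 (φ ∘ ℓ) t := fun t ht => by
    have h1 : ContMDiffAt 𝓘(ℝ, ℂ) 𝓘(ℝ, ℂ) 1 φ (ℓ t) := contMDiffAt_of_locIsometryAt hX (by
      filter_upwards [isOpen_ball.mem_nhds (hmem t ht)] with w hw using hφ w hw)
    have h2 : ContDiff ℝ 1 ℓ := contDiff_const.add (ofRealCLM.contDiff.mul contDiff_const)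
    exact h1.comp t h2.contDiffAt.contMDiffAt
  have hle := riemannianEDist_le_pathELength (I := 𝓘(ℝ, ℂ)) (γ := φ ∘ ℓ) (a := 0) (b := 1)
    (fun t ht => (hCM t ht).contMDiffWithinAt) (x := φ a) (y := φ b)
    (by simp [hℓ]) (by simp [hℓ]) zero_le_one
  refine hle.trans ?_
  rw [pathELength_eq_lintegral_mfderiv_Icc]
  -- On the ball the square root of the Poincaré density is at most `2 / (1 - R²)`; this bounds the
  -- speed of the image of the segment from `a` to `b`.
  have hbound : ∀ t ∈ Icc (0 : ℝ) 1, ‖mfderiv 𝓘(ℝ, ℝ) 𝓘(ℝ, ℂ) (φ ∘ ℓ) t (1 : ℝ)‖ₑ ≤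
      ENNReal.ofReal (2 / (1 - R ^ 2)) * edist a b := by
    intro t ht
    have h1 := hφ _ (hmem t ht)
    have h2 : HasMFDerivAt 𝓘(ℝ, ℝ) 𝓘(ℝ, ℂ) ℓ t (ContinuousLinearMap.toSpanSingleton ℝ (b - a)) :=
      (hℓd t).hasFDerivAt.hasMFDerivAt
    have h3 := h1.2.hasMFDerivAt.comp t h2
    rw [h3.mfderiv]
    have h4 := h1.3 ((1 : ℝ) • (b - a))
    have h5 : ‖mfderiv 𝓘(ℝ, ℂ) 𝓘(ℝ, ℂ) φ (ℓ t) ((1 : ℝ) • (b - a) : ℂ)‖ ≤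
        2 / (1 - R ^ 2) * dist a b := by
      refine (pow_le_pow_iff_left₀ (norm_nonneg _) (by positivity) two_ne_zero).1 ?_
      have h6 : ‖ℓ t‖ < R := by simpa using hmem t ht
      have h7 : ‖ℓ t‖ ^ 2 ≤ R ^ 2 := pow_le_pow_left₀ (norm_nonneg _) h6.le 2
      rw [h4, one_smul, dist_comm, dist_eq_norm, mul_pow, poincareDensity, div_pow]
      have h8 : (1 - R ^ 2) ^ 2 ≤ (1 - ‖ℓ t‖ ^ 2) ^ 2 := pow_le_pow_left₀ hpos.le (by linarith) 2
      norm_num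
      gcongr
    rw [edist_dist, ← ENNReal.ofReal_mul hR2, ← ofReal_norm]
    exact ENNReal.ofReal_le_ofReal h5
  calc _ ≤ ∫⁻ _ in Icc (0 : ℝ) 1, ENNReal.ofReal (2 / (1 - R ^ 2)) * edist a b :=
        MeasureTheory.setLIntegral_mono' measurableSet_Icc hbound
    _ = _ := by simp [ENNReal.ofReal]

/-- A local isometry extends across each boundary point of a disc of radius `R < 1`. -/
theorem exists_extension_near [CompleteSpace X]
    [IsContMDiffRiemannianBundle 𝓘(ℝ, ℂ) ∞ ℂ (fun x : X => TangentSpace 𝓘(ℝ, ℂ) x)]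
    [IsRiemannianManifold 𝓘(ℝ, ℂ) X] (hX : IsHyperbolicMetric X)
    {φ : ℂ → X} {R : ℝ} (hR0 : 0 < R) (hR : R < 1) (hφ : ∀ z ∈ ball (0 : ℂ) R, LocIsometryAt φ z)
    {ζ : ℂ} (hζ : ‖ζ‖ = R) :
    ∃ δ > 0, ∃ ψ : ℂ → X, (∀ z ∈ ball ζ δ, LocIsometryAt ψ z) ∧
      ∀ z ∈ ball ζ δ ∩ ball 0 R, ψ z = φ z := by
  have hne : (𝓝[ball (0 : ℂ) R] ζ).NeBot := by
    rw [← mem_closure_iff_nhdsWithin_neBot, closure_ball _ hR0.ne']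
    simp [hζ]
  have hlip := lipschitzOnWith_of_locIsometryAt hX hR0 hR hφ
  -- The Lipschitz bound makes `φ` Cauchy at the boundary point, so completeness supplies a limit
  -- `q` around which a local isometric coordinate `f` exists.
  have hcau : Cauchy (map φ (𝓝[ball (0 : ℂ) R] ζ)) :=
    (cauchy_nhds.mono nhdsWithin_le_nhds).map_of_le hlip.uniformContinuousOn
      (le_principal_iff.2 self_mem_nhdsWithin)
  obtain ⟨q, hq⟩ := CompleteSpace.complete hcau
  obtain ⟨s, hs, hs1, χ, f, V, hVo, hqV, hfq, hfc, hχ, hV, hiso⟩ := exists_local_isometry hX q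
  have hqt : Tendsto φ (𝓝[ball (0 : ℂ) R] ζ) (𝓝 q) := hq
  obtain ⟨δ₁, hδ₁, hδV⟩ := Metric.mem_nhdsWithin_iff.1 (hqt (hVo.mem_nhds hqV))
  have hWne : (ball ζ δ₁ ∩ ball 0 R).Nonempty :=
    hne.nonempty_of_mem (inter_mem (mem_nhdsWithin_of_mem_nhds (ball_mem_nhds ζ hδ₁)) self_mem_nhdsWithin)
  have hR1 : ball (0 : ℂ) R ⊆ ball 0 1 := ball_subset_ball hR.le
  -- On a convex lens touching `ζ`, `f ∘ φ` is an isometry between pieces of the disc, so it extends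
  -- across `ζ`. Since `A ζ = 0`, `χ ∘ A` is defined near `ζ` and continues `φ`.
  obtain ⟨A, hA, hfA⟩ := exists_extension_of_hypIsometry (h := f ∘ φ)
    (isOpen_ball.inter isOpen_ball)
    ((convex_ball ζ δ₁).inter (convex_ball 0 R)).isPreconnected
    (fun z hz => hR1 hz.2) hWne
    (fun z hz => hiso φ z (by simpa using hR1 hz.2) (hφ z hz.2) (hδV hz))
  have hζ1 : ζ ∈ ball (0 : ℂ) 1 := by simpa [hζ] using hR
  have hAc : ContinuousAt A ζ := (hA ζ hζ1).1.continuousAt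
  have hAζ : A ζ = 0 := by
    have h1 : Tendsto A (𝓝[ball (0 : ℂ) R] ζ) (𝓝 (A ζ)) := hAc.mono_left nhdsWithin_le_nhds
    have h2 : Tendsto (f ∘ φ) (𝓝[ball (0 : ℂ) R] ζ) (𝓝 0) := by
      have := hfc.tendsto.comp hqt
      rwa [hfq] at this
    refine tendsto_nhds_unique h1 (h2.congr' ?_)
    filter_upwards [inter_mem (mem_nhdsWithin_of_mem_nhds (ball_mem_nhds ζ hδ₁)) self_mem_nhdsWithin] with w hw using hfA hw
  obtain ⟨δ₂, hδ₂, hδA⟩ := Metric.mem_nhds_iff.1 (inter_mem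
    (hAc.preimage_mem_nhds (by rw [hAζ]; exact ball_mem_nhds 0 hs)) (isOpen_ball.mem_nhds hζ1))
  refine ⟨min δ₁ δ₂, by positivity, χ ∘ A, fun z hz => ?_, fun z hz => ?_⟩
  · have h1 := hδA (ball_subset_ball (min_le_right _ _) hz)
    exact LocIsometryAt.comp (by simpa using h1.2) (hχ _ h1.1) (hA z h1.2)
  · have h1 : z ∈ ball ζ δ₁ ∩ ball 0 R := ⟨ball_subset_ball (min_le_left _ _) hz.1, hz.2⟩
    rw [Function.comp_apply, ← hfA h1]
    exact (hV _ (hδV h1)).2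

/-- A local isometry on a disc of radius `R < 1` extends to a larger disc. -/
theorem exists_extension [CompleteSpace X]
    [IsContMDiffRiemannianBundle 𝓘(ℝ, ℂ) ∞ ℂ (fun x : X => TangentSpace 𝓘(ℝ, ℂ) x)]
    [IsRiemannianManifold 𝓘(ℝ, ℂ) X] (hX : IsHyperbolicMetric X)
    {φ : ℂ → X} {R : ℝ} (hR0 : 0 < R) (hR : R < 1)
    (hφ : ∀ z ∈ ball (0 : ℂ) R, LocIsometryAt φ z) :
    ∃ R', R < R' ∧ R' ≤ 1 ∧ ∃ Φ : ℂ → X, (∀ z ∈ ball (0 : ℂ) R', LocIsometryAt Φ z) ∧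
      EqOn Φ φ (ball 0 R) := by
  have hloc : ∀ ζ : sphere (0 : ℂ) R, ∃ δ > 0, ∃ ψ : ℂ → X,
      (∀ z ∈ ball (ζ : ℂ) δ, LocIsometryAt ψ z) ∧ ∀ z ∈ ball (ζ : ℂ) δ ∩ ball 0 R, ψ z = φ z :=
    fun ζ => exists_extension_near hX hR0 hR hφ (by simp)
  choose d hd ψ hψ hψφ using hloc
  obtain ⟨δ, hδ, hleb⟩ := lebesgue_number_lemma_of_metric (isCompact_sphere (0 : ℂ) R)
    (c := fun ζ : sphere (0 : ℂ) R => ball (ζ : ℂ) (d ζ)) (fun _ => isOpen_ball)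
    (fun ζ hζ => mem_iUnion.2 ⟨⟨ζ, hζ⟩, mem_ball_self (hd _)⟩)
  have hunif : ∀ ζ ∈ sphere (0 : ℂ) R, ∃ ψ : ℂ → X,
      (∀ z ∈ ball ζ δ, LocIsometryAt ψ z) ∧ ∀ z ∈ ball ζ δ ∩ ball 0 R, ψ z = φ z := by
    intro ζ hζ
    obtain ⟨i, hi⟩ := hleb ζ hζ
    exact ⟨ψ i, fun z hz => hψ i z (hi hz), fun z hz => hψφ i z ⟨hi hz.1, hz.2⟩⟩
  have : Nonempty X := ⟨φ 0⟩
  choose! Ψ hΨ hΨφ using hunif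
  -- Radial projection to the circle: beyond radius `R` the extension at `z` uses the local
  -- continuation centred at `pr z`.
  set pr : ℂ → ℂ := fun z => ((R / ‖z‖ : ℝ) : ℂ) * z with hpr
  have hprs : ∀ z : ℂ, R ≤ ‖z‖ → pr z ∈ sphere (0 : ℂ) R := fun z hz => by
    have : 0 < ‖z‖ := hR0.trans_le hz
    rw [mem_sphere_zero_iff_norm, hpr]
    simp only [norm_mul, norm_real, Real.norm_eq_abs]
    rw [abs_of_pos (by positivity), div_mul_cancel₀ _ this.ne']
  have hprd : ∀ z : ℂ, R ≤ ‖z‖ → ‖z‖ < R + δ → z ∈ ball (pr z) δ := fun z hz hz2 => by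
    have : 0 < ‖z‖ := hR0.trans_le hz
    have h1 : z - pr z = ((1 - R / ‖z‖ : ℝ) : ℂ) * z := by simp only [hpr]; push_cast; ring
    have h2 : 0 ≤ 1 - R / ‖z‖ := by rw [sub_nonneg, div_le_one this]; exact hz
    rw [mem_ball, dist_eq_norm, h1, norm_mul, norm_real, Real.norm_eq_abs, abs_of_nonneg h2,
      sub_mul, div_mul_cancel₀ _ this.ne']
    linarith
  set Φ : ℂ → X := fun z => if ‖z‖ < R then φ z else Ψ (pr z) z with hΦ
  have hΦφ : ∀ z : ℂ, ‖z‖ < R → Φ z = φ z := fun z hz => if_pos hz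
  refine ⟨min (R + δ) 1, lt_min (by linarith) hR, min_le_right _ _, Φ, fun z₀ hz₀ => ?_,
    fun z hz => hΦφ z (by simpa using hz)⟩
  have hz₀δ : ‖z₀‖ < R + δ := by simpa using ball_subset_ball (min_le_left _ _) hz₀
  rcases lt_or_ge ‖z₀‖ R with h | h
  · refine (hφ z₀ (by simpa using h)).congr ?_
    filter_upwards [continuous_norm.continuousAt.eventually_lt continuousAt_const h] with w hw
    exact hΦφ w hw
  · have hs₀ := hprs z₀ h
    have hb₀ := hprd z₀ h hz₀δ
    refine (hΨ _ hs₀ z₀ hb₀).congr ?_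
    filter_upwards [isOpen_ball.mem_nhds hb₀,
      continuous_norm.continuousAt.eventually_lt continuousAt_const hz₀δ] with w hw hwδ
    rcases lt_or_ge ‖w‖ R with hwR | hwR
    · rw [hΦφ w hwR, hΨφ _ hs₀ w ⟨hw, by simpa using hwR⟩]
    · have hsw := hprs w hwR
      have hbw := hprd w hwR hwδ
      have e1 : Φ w = Ψ (pr w) w := if_neg (not_lt.2 hwR)
      rw [e1]
      rcases eq_or_ne (pr w) (pr z₀) with heq | hneq
      · rw [heq]
      -- Two local continuations are compared at the midpoint of their centres. Strict convexity
      -- puts it inside the disc of radius `R`, where both equal `φ`, and it lies in both balls,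
      -- whose intersection is convex.
      set m : ℂ := (1 / 2 : ℝ) • (pr w + pr z₀) with hm
      have hn1 : ‖pr w‖ = R := by simpa using hsw
      have hn2 : ‖pr z₀‖ = R := by simpa using hs₀
      have hmR : m ∈ ball (0 : ℂ) R := by
        rw [mem_ball_zero_iff, ← hn1]
        exact (norm_midpoint_lt_iff (hn1.trans hn2.symm)).2 hneq
      have hdist : dist (pr w) (pr z₀) < 2 * δ := by
        have := dist_triangle_left (pr w) (pr z₀) w
        rw [mem_ball] at hw hbw
        linarith
      have hm1 : m ∈ ball (pr w) δ := by
        have : m - pr w = (1 / 2 : ℝ) • (pr z₀ - pr w) := by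
          rw [hm, smul_sub, smul_add]; module
        rw [mem_ball, dist_eq_norm, this, norm_smul, ← dist_eq_norm, dist_comm]
        norm_num; linarith
      have hm2 : m ∈ ball (pr z₀) δ := by
        have : m - pr z₀ = (1 / 2 : ℝ) • (pr w - pr z₀) := by
          rw [hm, smul_sub, smul_add]; module
        rw [mem_ball, dist_eq_norm, this, norm_smul, ← dist_eq_norm]
        norm_num; linarith
      refine eqOn_of_eventuallyEq (U := ball (pr w) δ ∩ ball (pr z₀) δ)
        ((convex_ball _ _).inter (convex_ball _ _)).isPreconnected ?_ ?_ (z₀ := m)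
        ⟨hm1, hm2⟩ ?_ ⟨hbw, hw⟩
      · intro z hz
        filter_upwards [isOpen_ball.mem_nhds hz.1] with y hy using (hΨ _ hsw y hy).1
      · intro z hz
        filter_upwards [isOpen_ball.mem_nhds hz.2] with y hy using (hΨ _ hs₀ y hy).1
      · filter_upwards [isOpen_ball.mem_nhds hm1, isOpen_ball.mem_nhds hm2,
          isOpen_ball.mem_nhds hmR] with y h1 h2 h3
        rw [hΨφ _ hsw y ⟨h1, h3⟩, hΨφ _ hs₀ y ⟨h2, h3⟩]

/-- Every point of a complete hyperbolic surface is the image of the origin under a local isometry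
from the Poincaré disc. -/
theorem exists_isometry_disc [CompleteSpace X]
    [IsContMDiffRiemannianBundle 𝓘(ℝ, ℂ) ∞ ℂ (fun x : X => TangentSpace 𝓘(ℝ, ℂ) x)]
    [IsRiemannianManifold 𝓘(ℝ, ℂ) X] (hX : IsHyperbolicMetric X) (p : X) :
    ∃ φ : ℂ → X, (∀ z ∈ ball (0 : ℂ) 1, LocIsometryAt φ z) ∧ φ 0 = p := by
  obtain ⟨s, hs, hs1, χ, f, V, -, hpV, hfp, -, hχ, hV, -⟩ := exists_local_isometry hX p
  have hχ0 : χ 0 = p := by rw [← hfp]; exact (hV p hpV).2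
  -- Requiring agreement with the fixed germ `χ` makes the extensions unique, so those for different
  -- radii glue.
  set S : Set ℝ := {r | s ≤ r ∧ r ≤ 1 ∧ ∃ φ : ℂ → X, (∀ z ∈ ball (0 : ℂ) r, LocIsometryAt φ z) ∧
    EqOn φ χ (ball 0 s)} with hS
  have hsS : s ∈ S := ⟨le_rfl, hs1, χ, hχ, fun _ _ => rfl⟩
  have hbdd : BddAbove S := ⟨1, fun r hr => hr.2.1⟩
  set R := sSup S with hR
  have hsR : s ≤ R := le_csSup hbdd hsS
  have hR1 : R ≤ 1 := csSup_le ⟨s, hsS⟩ fun r hr => hr.2.1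
  have hex : ∀ r ∈ S, ∃ φ : ℂ → X, (∀ z ∈ ball (0 : ℂ) r, LocIsometryAt φ z) ∧
    EqOn φ χ (ball 0 s) := fun r hr => hr.2.2
  have : Nonempty X := ⟨p⟩
  choose! Φ hΦ hΦχ using hex
  have huniq : ∀ r ∈ S, ∀ r' ∈ S, ∀ z : ℂ, ‖z‖ < r → ‖z‖ < r' → Φ r z = Φ r' z := by
    intro r hr r' hr' z hz hz'
    refine eqOn_of_eventuallyEq (U := ball (0 : ℂ) (min r r')) (convex_ball _ _).isPreconnected
      ?_ ?_ (z₀ := 0) (mem_ball_self (lt_min (hs.trans_le hr.1) (hs.trans_le hr'.1))) ?_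
      (by simpa using ⟨hz, hz'⟩)
    · intro z hz
      filter_upwards [isOpen_ball.mem_nhds (ball_subset_ball (min_le_left _ _) hz)] with y hy
        using (hΦ r hr y hy).1
    · intro z hz
      filter_upwards [isOpen_ball.mem_nhds (ball_subset_ball (min_le_right _ _) hz)] with y hy
        using (hΦ r' hr' y hy).1
    · filter_upwards [ball_mem_nhds (0 : ℂ) hs] with y hy
      rw [hΦχ r hr hy, hΦχ r' hr' hy]
  have hsel : ∀ z : ℂ, ∃ r, ‖z‖ < R → r ∈ S ∧ ‖z‖ < r := by
    intro z
    by_cases h : ‖z‖ < R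
    · obtain ⟨r, hr, hzr⟩ := exists_lt_of_lt_csSup ⟨s, hsS⟩ h
      exact ⟨r, fun _ => ⟨hr, hzr⟩⟩
    · exact ⟨0, fun h' => absurd h' h⟩
  choose ρ hρ using hsel
  -- The glued map shows that the supremum `R` is attained, so `R < 1` would contradict
  -- extendability.
  have hRiso : ∀ z ∈ ball (0 : ℂ) R, LocIsometryAt (fun w => Φ (ρ w) w) z := by
    intro z hz
    have hzR : ‖z‖ < R := by simpa using hz
    obtain ⟨h1, h2⟩ := hρ z hzR
    refine (hΦ _ h1 z (by simpa using h2)).congr ?_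
    filter_upwards [continuous_norm.continuousAt.eventually_lt continuousAt_const hzR,
      continuous_norm.continuousAt.eventually_lt continuousAt_const h2] with w hw hw2
    exact huniq _ (hρ w hw).1 _ h1 w (hρ w hw).2 hw2
  have hReq : EqOn (fun w => Φ (ρ w) w) χ (ball 0 s) := fun z hz => by
    have hzR : ‖z‖ < R := lt_of_lt_of_le (by simpa using hz) hsR
    exact hΦχ _ (hρ z hzR).1 hz
  rcases hR1.lt_or_eq with hlt | heq
  · exfalso
    obtain ⟨R', hRR', hR'1, Ψ, hΨ, hΨeq⟩ := exists_extension hX (hs.trans_le hsR) hlt hRiso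
    have : R' ∈ S := ⟨hsR.trans hRR'.le, hR'1, Ψ, hΨ, fun z hz =>
      (hΨeq (ball_subset_ball hsR hz)).trans (hReq hz)⟩
    exact absurd (le_csSup hbdd this) (not_le.2 hRR')
  · rw [heq] at hRiso
    refine ⟨_, hRiso, ?_⟩
    exact (hReq (mem_ball_self hs)).trans hχ0

end Continuation

/-! ### The zero solution and its maximality. -/

/-- The zero tuple solves the system with coefficients `i (n - i)`. -/
theorem isSolution_zero {X : Type*} [TopologicalSpace X] [ChartedSpace ℂ X]
    [RiemannianBundle (fun x : X => TangentSpace 𝓘(ℝ, ℂ) x)] (n : ℕ) :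
    IsSolution (X := X) n (fun i _ => (i : ℝ) * ((n : ℝ) - (i : ℝ))) (fun _ _ => 0) where
  zero_left _ := rfl
  zero_right _ := rfl
  smooth _ _ _ := contMDiff_const
  eq_zero i _ _ e _ z _ := by
    have h : Laplacian.laplacian (fun _ : ℂ => (0 : ℝ)) z = 0 :=
      congrFun InnerProductSpace.laplacian_const z
    simp only [systemLHS, laplaceBeltrami, h]
    simp

/-- Subsolutions of the system with coefficients `i (n - i)` on a complete hyperbolic surface are
nonpositive. -/
theorem IsSubsolution.nonpos {X : Type*} [MetricSpace X] [ChartedSpace ℂ X]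
    [IsManifold 𝓘(ℂ, ℂ) ω X]
    [RiemannianBundle (fun x : X => TangentSpace 𝓘(ℝ, ℂ) x)]
    [IsContMDiffRiemannianBundle 𝓘(ℝ, ℂ) ∞ ℂ (fun x : X => TangentSpace 𝓘(ℝ, ℂ) x)]
    [IsRiemannianManifold 𝓘(ℝ, ℂ) X] [CompleteSpace X]
    (hX : IsHyperbolicMetric X) {n : ℕ} {v : ℕ → X → ℝ}
    (hv : IsSubsolution n (fun i _ => (i : ℝ) * ((n : ℝ) - (i : ℝ))) v)
    {i : ℕ} (hi : 1 ≤ i) (hin : i < n) (x : X) : v i x ≤ 0 := by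
  -- Centring the disc at `x` reduces the claim to the value of the pulled-back tuple at the origin.
  obtain ⟨φ, hφ, rfl⟩ := exists_isometry_disc hX x
  have hev : ∀ z ∈ Metric.ball (0 : ℂ) 1, ∀ᶠ w in nhds z, LocIsometryAt φ w := fun z hz => by
    filter_upwards [Metric.isOpen_ball.mem_nhds hz] with w hw using hφ w hw
  have hP : ∀ z ∈ Metric.ball (0 : ℂ) 1, 0 < poincareDensity z := fun z hz => by
    have := one_sub_sq_pos (show ‖z‖ < 1 by simpa using hz)
    unfold poincareDensity
    positivity
  have hpull : ∀ i, 1 ≤ i → i < n → ∀ z ∈ Metric.ball (0 : ℂ) 1, _ := fun i h1 h2 z hz =>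
    LocIsometryAt.laplacian_comp hX (hev z hz) (chart_mem_atlas ℂ (φ z))
      (mem_chart_source ℂ (φ z)) (hP z hz) (hv.smooth i h1 h2)
  refine subsolution_disc_nonpos (n := n) (V := fun i z => v i (φ z))
    (fun z => hv.zero_left _) (fun z => hv.zero_right _)
    (fun i h1 h2 z hz => (hpull i h1 h2 z hz).1) (fun i h1 h2 z hz => ?_) hi hin
  rw [(hpull i h1 h2 z hz).2]
  refine mul_le_mul_of_nonneg_left ?_ (hP z hz).le
  have h3 := hv.nonneg i h1 h2 (chartAt ℂ (φ z)) (chart_mem_atlas ℂ (φ z)) _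
    ((chartAt ℂ (φ z)).map_source (mem_chart_source ℂ (φ z)))
  simp only [systemLHS, (chartAt ℂ (φ z)).left_inv (mem_chart_source ℂ (φ z))] at h3
  linarith

end HyperbolicToda

theorem proposition4p4 {X : Type*} [MetricSpace X] [ChartedSpace ℂ X] [IsManifold 𝓘(ℂ, ℂ) ω X]
    [ConnectedSpace X] [NoncompactSpace X]
    [RiemannianBundle (fun x : X => TangentSpace 𝓘(ℝ, ℂ) x)]
    [IsContMDiffRiemannianBundle 𝓘(ℝ, ℂ) ∞ ℂ (fun x : X => TangentSpace 𝓘(ℝ, ℂ) x)]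
    [IsRiemannianManifold 𝓘(ℝ, ℂ) X] [CompleteSpace X]
    (hX : HyperbolicToda.IsHyperbolicMetric X) (n : ℕ) :
    HyperbolicToda.IsMaximalSolution (X := X) n
      (fun i _ => (i : ℝ) * ((n : ℝ) - (i : ℝ))) (fun _ _ => 0) where
  toIsSolution := HyperbolicToda.isSolution_zero n
  le _ hv _ hi hin x := hv.nonpos hX hi hin x
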